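/- Let $N_F\ge 2$ and let $I=\{0,1\}^{N_F}$, with parity $|i|=\sum_f i_f \bmod 2$. Consider families $A=(A^i)_{i\in I}$ of complex $2\times 2$ matrices such that - (fMPS) there is a matrix $Z$ unitarily equivalent to $\sigma_z$ with $(-1)^{|i|}A^i=ZA^iZ$ for all $i$; - (graded injective, Wall invariant $(-)$) there are a unitary $W$ and $b^i\in\mathbb C$ with $A^i=W(b^i\sigma_x^{|i|})W^\dagger$, and a length $l$ such that the products $b^{i_1}\cdots b^{i_l}$ with $\sum_k|i_k|$ even span $\mathbb C$, and so do those with $\sum_k|i_k|$ odd; - (canonical form) $\sum_i A^iA^{i\dagger}=1$. Call two families gauge equivalent if for every $L$ there is a phase $e^{i\alpha_L}$ with $\mathrm{tr}(A^{i_1}\cdots A^{i_L})=e^{i\alpha_L}\,\mathrm{tr}(\tilde A^{i_1}\cdots\tilde A^{i_L})$ for all $i_1,\dots,i_L\in I$. Let $\mathcal M$ be the quotient of the space of these families by gauge equivalence, with the quotient topology (the space of injective fMPSs of bond dimension 2 with $N_F$ flavors in the non-trivial phase). For $p\in I$ let $\mathcal M_p\subset\mathcal M$ be the locus of classes with $A^p\neq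 0$. Then: 1. For every even $p\in I$ (in particular for the vacuum label $p=0$), $\mathcal M_p$ is homotopy equivalent to $\mathbb{RP}^{2^{N_F}-1}$. 2. $\pi_1(\mathcal M_0)\cong\mathbb Z/2$. Moreover the whole space $\mathcal M$ is path connected and $\pi_1(\mathcal M)\cong\mathbb Z/2$. 3. For a flavor $f$, let $e_f\in I$ be the label with one fermion of flavor $f$ and no other. Both groups are generated by the class of the loop, $\theta\in[0,2\pi]$, $$A^{0}(\theta)=\tfrac{1}{\sqrt2}\,1_2,\qquad A^{e_f}(\theta)=\tfrac{e^{i\theta/2}}{\sqrt2}\,\sigma_x,\qquad A^i(\theta)=0 \text{ otherwise}.$$ This loop is the $2\pi$ rotation of the gap phase of the Kitaev chain: for all $L\ge2$ and $\theta\in\mathbb R$, the state with wave function $\mathrm{tr}(A^{i_1}(\theta)\cdots A^{i_L}(\theta))$ is a ground state of $H(-\theta)$, where, with $a_{L+1,f}=-a_{1,f}$ (anti-periodic boundary condition), $$H(\vartheta)=-\sum_{j=1}^{L}\bigl(a^\dagger_{j+1,f}a_{j,f}+e^{i\vartheta}a_{j+1,f}a_{j,f}+\mathrm{h.c.}\bigr)+\sum_{g\ne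 f}\sum_{j=1}^L a^\dagger_{j,g}a_{j,g}.$$ -/

import Mathlib

open scoped Kronecker ContinuousMap

noncomputable section

namespace FMPS

/-! ### Occupation labels and fermionic matrix product states -/

/-- Basis labels of the local Hilbert space: occupation numbers of `NF` fermionic flavors. -/
abbrev Occ (NF : ℕ) : Type := Fin NF → ZMod 2

/-- Fermion parity `|i|` of a basis label. -/
def parity {NF : ℕ} (i : Occ NF) : ZMod 2 := ∑ f, i f

/-- Matrices acting on the bond space `ℂ² ⊗ ℂⁿ` of dimension `2n`. -/
abbrev BondMatrix (n : ℕ) : Type := Matrix (Fin 2 × Fin n) (Fin 2 × Fin n) ℂ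

/-- The Pauli matrix `σ_x`. -/
def sigmaX : Matrix (Fin 2) (Fin 2) ℂ := !![0, 1; 1, 0]

/-- The Pauli matrix `σ_z`. -/
def sigmaZ : Matrix (Fin 2) (Fin 2) ℂ := !![1, 0; 0, -1]

/-- The ordered product `A^{i_1} ⋯ A^{i_L}` along a word `i_1, …, i_L`. -/
def wordProd {NF L : ℕ} {m : Type*} [Fintype m] [DecidableEq m]
    (A : Occ NF → Matrix m m ℂ) (w : Fin L → Occ NF) : Matrix m m ℂ :=
  (List.ofFn fun k => A (w k)).prod

/-- The family `A` is a fermionic MPS of bond dimension `2n`: there is a grading matrix `Z`,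
unitarily equivalent to `σ_z ⊗ 1_n`, with `(-1)^{|i|} A^i = Z A^i Z`. -/
def IsFMPS {NF : ℕ} (n : ℕ) (A : Occ NF → BondMatrix n) : Prop :=
  ∃ Z : BondMatrix n,
    (∃ U ∈ Matrix.unitaryGroup (Fin 2 × Fin n) ℂ,
      Z = star U * (sigmaZ ⊗ₖ (1 : Matrix (Fin n) (Fin n) ℂ)) * U) ∧
    ∀ i, ((-1 : ℂ) ^ (parity i).val) • A i = Z * A i * Z

/-- Graded injectivity with Wall invariant `(-)`. The Wall matrix is
`u = W (σ_x ⊗ 1_n) W†`; at one and the same length `l`, the even words and the odd words in the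
`B^i` each span `M_n(ℂ)`. -/
def IsInjectiveMinus {NF : ℕ} (n : ℕ) (A : Occ NF → BondMatrix n) : Prop :=
  ∃ W ∈ Matrix.unitaryGroup (Fin 2 × Fin n) ℂ, ∃ B : Occ NF → Matrix (Fin n) (Fin n) ℂ,
    (∀ i, A i = W * ((sigmaX ^ (parity i).val) ⊗ₖ B i) * star W) ∧
    ∃ l : ℕ, ∀ s : ZMod 2,
      Submodule.span ℂ {M : Matrix (Fin n) (Fin n) ℂ |
        ∃ w : Fin l → Occ NF, ∑ k, parity (w k) = s ∧ M = wordProd B w} = ⊤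

/-- The canonical form `∑ A^i A^{i†} = 1`. -/
def IsCanonical {NF : ℕ} (n : ℕ) (A : Occ NF → BondMatrix n) : Prop :=
  ∑ i, A i * star (A i) = 1

/-- The space of injective fMPSs in canonical form in the non-trivial phase (before dividing by the
gauge redundancy), with bond dimension `2n` and `NF` flavors, as a subspace of the space of
families of matrices. -/
abbrev NonTrivTilde (n NF : ℕ) : Type :=
  {A : Occ NF → BondMatrix n // IsFMPS n A ∧ IsInjectiveMinus n A ∧ IsCanonical n A}

/-- The wave function `ψ(i_1,…,i_L) = tr(Ω A^{i_1} ⋯ A^{i_L})` of the fMPS with boundary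
matrix `Ω`. -/
def state {NF n : ℕ} (Ω : BondMatrix n) (A : Occ NF → BondMatrix n) (L : ℕ) :
    (Fin L → Occ NF) → ℂ :=
  fun w => (Ω * wordProd A w).trace

/-- Gauge equivalence: for every length the states with trivial boundary matrix (anti-periodic
boundary condition) agree up to a phase. -/
def GaugeEquiv {NF n : ℕ} (A A' : Occ NF → BondMatrix n) : Prop :=
  ∀ L : ℕ, ∃ c : ℂ, ‖c‖ = 1 ∧ state 1 A L = c • state 1 A' L

instance gaugeSetoid (n NF : ℕ) : Setoid (NonTrivTilde n NF) where
  r A A' := GaugeEquiv A.1 A'.1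
  iseqv :=
    { refl := fun _ _ => ⟨1, by simp, by simp⟩
      symm := by
        intro A A' h L
        obtain ⟨c, hc, e⟩ := h L
        have hc0 : c ≠ 0 := by
          rintro rfl
          simp at hc
        exact ⟨c⁻¹, by simp [hc], by rw [e, smul_smul, inv_mul_cancel₀ hc0, one_smul]⟩
      trans := by
        intro A A' A'' h h' L
        obtain ⟨c, hc, e⟩ := h L
        obtain ⟨d, hd, e'⟩ := h' L
        exact ⟨c * d, by simp [hc, hd], by rw [e, e', smul_smul]⟩ }

/-- The space of injective fMPSs in the non-trivial phase divided by the gauge redundancy, with the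
quotient topology. -/
abbrev NonTriv (n NF : ℕ) : Type := Quotient (gaugeSetoid n NF)

/-- The locus of gauge classes with `A^p ≠ 0`. -/
def locus (n NF : ℕ) (p : Occ NF) : Set (NonTriv n NF) :=
  {q | ∃ A : NonTrivTilde n NF, A.1 p ≠ 0 ∧ (⟦A⟧ : NonTriv n NF) = q}

/-! ### Real projective space -/

/-- Antipodal identification on the unit sphere of `ℝ^{d+1}`. -/
instance antipodalSetoid (d : ℕ) :
    Setoid (Metric.sphere (0 : EuclideanSpace ℝ (Fin (d + 1))) 1) where
  r x y := x = y ∨ x = -y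
  iseqv :=
    { refl := fun _ => Or.inl rfl
      symm := by
        rintro x y (h | h)
        · exact Or.inl h.symm
        · exact Or.inr (by rw [h, neg_neg])
      trans := by
        rintro x y z (h | h) (h' | h')
        · exact Or.inl (h.trans h')
        · exact Or.inr (h.trans h')
        · exact Or.inr (by rw [h, h'])
        · exact Or.inl (by rw [h, h', neg_neg]) }

/-- Real projective space `ℝP^d = S^d / (x ∼ -x)` with the quotient topology. -/
abbrev RP (d : ℕ) : Type := Quotient (antipodalSetoid d)

/-! ### The loop of Kitaev chains -/

/-- The coefficients `B^i` of the family with phase `θ`: amplitude `1/√2` on the vacuum,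
`e^{iθ/2}/√2` on the state with one fermion of flavor `f`, and `0` otherwise. -/
def kitaevCoeff {NF : ℕ} (f : Fin NF) (θ : ℝ) (i : Occ NF) : ℂ :=
  if i = 0 then 1 / (Real.sqrt 2 : ℂ)
  else if i = Pi.single f 1 then Complex.exp (Complex.I * θ / 2) / (Real.sqrt 2 : ℂ)
  else 0

/-- The matrices `A^i = σ_x^{|i|} ⊗ B^i` of the Kitaev chain in flavor `f`, at phase `θ`. -/
def kitaevMatrices {NF : ℕ} (f : Fin NF) (θ : ℝ) (i : Occ NF) : BondMatrix 1 :=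
  (sigmaX ^ (parity i).val) ⊗ₖ (kitaevCoeff f θ i • (1 : Matrix (Fin 1) (Fin 1) ℂ))

lemma sigmaX_sq : sigmaX * sigmaX = 1 := by
  ext a b
  fin_cases a <;> fin_cases b <;> simp [sigmaX]

lemma sigmaZ_sq : sigmaZ * sigmaZ = 1 := by
  ext a b
  fin_cases a <;> fin_cases b <;> simp [sigmaZ]

lemma sigmaX_star : star sigmaX = sigmaX := by
  ext a b
  fin_cases a <;> fin_cases b <;> simp [sigmaX]

lemma sigmaZXZ : sigmaZ * sigmaX * sigmaZ = -sigmaX := by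
  ext a b
  fin_cases a <;> fin_cases b <;> simp [sigmaX, sigmaZ]

lemma zmod_two_val (s : ZMod 2) : s.val = 0 ∨ s.val = 1 := by
  have := ZMod.val_lt s
  omega

lemma grading_kronecker {n : ℕ} (s : ZMod 2) (B : Matrix (Fin n) (Fin n) ℂ) :
    ((-1 : ℂ) ^ s.val) • ((sigmaX ^ s.val) ⊗ₖ B) =
      (sigmaZ ⊗ₖ (1 : Matrix (Fin n) (Fin n) ℂ)) * ((sigmaX ^ s.val) ⊗ₖ B) *
        (sigmaZ ⊗ₖ (1 : Matrix (Fin n) (Fin n) ℂ)) := by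
  rw [← Matrix.mul_kronecker_mul, ← Matrix.mul_kronecker_mul]
  rcases zmod_two_val s with h | h <;> rw [h]
  · simp [sigmaZ_sq]
  · rw [pow_one, pow_one, sigmaZXZ, one_mul, mul_one, ← neg_one_smul ℂ sigmaX,
      Matrix.smul_kronecker]

lemma single_ne_zero {NF : ℕ} (f : Fin NF) : (Pi.single f 1 : Occ NF) ≠ 0 := by
  intro h
  have := congrFun h f
  simp at this

lemma parity_zero {NF : ℕ} : parity (0 : Occ NF) = 0 := by simp [parity]

lemma parity_single {NF : ℕ} (f : Fin NF) : parity (Pi.single f 1 : Occ NF) = 1 := by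
  simp [parity]

lemma sqrt_two_ne : (Real.sqrt 2 : ℂ) ≠ 0 := by
  norm_num

lemma kitaevCoeff_zero {NF : ℕ} (f : Fin NF) (θ : ℝ) :
    kitaevCoeff f θ 0 = 1 / (Real.sqrt 2 : ℂ) := by simp [kitaevCoeff]

lemma kitaevCoeff_single {NF : ℕ} (f : Fin NF) (θ : ℝ) :
    kitaevCoeff f θ (Pi.single f 1) =
      Complex.exp (Complex.I * θ / 2) / (Real.sqrt 2 : ℂ) := by
  simp [kitaevCoeff]

lemma kitaev_isFMPS {NF : ℕ} (f : Fin NF) (θ : ℝ) : IsFMPS 1 (kitaevMatrices f θ) :=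
  ⟨sigmaZ ⊗ₖ 1, ⟨1, one_mem _, by simp⟩, fun i => grading_kronecker _ _⟩

lemma span_eq_top_of_mem {S : Set (Matrix (Fin 1) (Fin 1) ℂ)} {c : ℂ} (hc : c ≠ 0)
    (h : c • (1 : Matrix (Fin 1) (Fin 1) ℂ) ∈ S) : Submodule.span ℂ S = ⊤ := by
  rw [eq_top_iff]
  intro M _
  have : M = (M 0 0 * c⁻¹) • (c • (1 : Matrix (Fin 1) (Fin 1) ℂ)) := by
    ext a b
    fin_cases a; fin_cases b
    simp [hc]
  rw [this]
  exact Submodule.smul_mem _ _ (Submodule.subset_span h)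

lemma kitaev_isInjectiveMinus {NF : ℕ} (f : Fin NF) (θ : ℝ) :
    IsInjectiveMinus 1 (kitaevMatrices f θ) := by
  refine ⟨1, one_mem _, fun i => kitaevCoeff f θ i • 1, fun i => by simp [kitaevMatrices],
    2, fun s => ?_⟩
  have h0 : kitaevCoeff f θ 0 ≠ 0 := by
    rw [kitaevCoeff_zero]
    exact div_ne_zero one_ne_zero sqrt_two_ne
  have h1 : kitaevCoeff f θ (Pi.single f 1) ≠ 0 := by
    rw [kitaevCoeff_single]
    exact div_ne_zero (Complex.exp_ne_zero _) sqrt_two_ne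
  rcases zmod_two_val s with h | h
  · have hs : s = 0 := (ZMod.val_eq_zero s).1 h
    refine span_eq_top_of_mem (mul_ne_zero h0 h0) ⟨![0, 0], ?_, ?_⟩
    · simp [hs, parity_zero]
    · simp [wordProd, smul_smul]
  · have hs : s = 1 := by
      apply ZMod.val_injective 2
      rw [h]
      rfl
    refine span_eq_top_of_mem (mul_ne_zero h0 h1) ⟨![0, Pi.single f 1], ?_, ?_⟩
    · simp [hs, parity_zero, parity_single]
    · simp [wordProd, smul_smul, mul_comm]

lemma kitaev_isCanonical {NF : ℕ} (f : Fin NF) (θ : ℝ) :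
    IsCanonical 1 (kitaevMatrices f θ) := by
  have key : ∀ i : Occ NF, kitaevMatrices f θ i * star (kitaevMatrices f θ i) =
      (kitaevCoeff f θ i * star (kitaevCoeff f θ i)) • (1 : BondMatrix 1) := by
    intro i
    have hX : sigmaX ^ (parity i).val * star (sigmaX ^ (parity i).val) = 1 := by
      rcases zmod_two_val (parity i) with h | h <;> rw [h]
      · simp
      · rw [pow_one, sigmaX_star, sigmaX_sq]
    rw [kitaevMatrices, Matrix.star_eq_conjTranspose, Matrix.conjTranspose_kronecker,
      ← Matrix.mul_kronecker_mul, ← Matrix.star_eq_conjTranspose, hX]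
    simp [smul_smul, mul_comm, Matrix.kronecker_smul]
  have hs : ((Real.sqrt 2 : ℝ) : ℂ) * (Real.sqrt 2 : ℝ) = 2 := by
    rw [← Complex.ofReal_mul, Real.mul_self_sqrt (by norm_num)]
    norm_num
  have e0 : kitaevCoeff f θ 0 * star (kitaevCoeff f θ 0) = 1 / 2 := by
    rw [kitaevCoeff_zero]
    simp only [Complex.star_def, map_div₀, map_one, Complex.conj_ofReal]
    rw [div_mul_div_comm, hs, one_mul]
  have e1 : kitaevCoeff f θ (Pi.single f 1) * star (kitaevCoeff f θ (Pi.single f 1)) = 1 / 2 := by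
    rw [kitaevCoeff_single]
    simp only [Complex.star_def, map_div₀, Complex.conj_ofReal]
    rw [div_mul_div_comm, hs, ← Complex.exp_conj, ← Complex.exp_add]
    simp only [map_div₀, map_mul, Complex.conj_I, Complex.conj_ofReal, map_ofNat]
    congr 1
    rw [← Complex.exp_zero]
    congr 1
    ring
  have hsum : ∑ i : Occ NF, kitaevCoeff f θ i * star (kitaevCoeff f θ i) = 1 := by
    rw [← Finset.sum_subset (Finset.subset_univ {0, Pi.single f 1}),
      Finset.sum_pair (single_ne_zero f).symm, e0, e1]
    · norm_num
    · intro i _ hi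
      simp only [Finset.mem_insert, Finset.mem_singleton, not_or] at hi
      simp [kitaevCoeff, hi.1, hi.2]
  rw [IsCanonical, Finset.sum_congr rfl fun i _ => key i, ← Finset.sum_smul, hsum, one_smul]

/-- The Kitaev family as a point of the space of injective fMPSs in the non-trivial phase. -/
def kitaevMPS {NF : ℕ} (f : Fin NF) (θ : ℝ) : NonTrivTilde 1 NF :=
  ⟨kitaevMatrices f θ, kitaev_isFMPS f θ, kitaev_isInjectiveMinus f θ, kitaev_isCanonical f θ⟩

lemma kitaevMPS_mem_locus {NF : ℕ} (f : Fin NF) (θ : ℝ) :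
    (⟦kitaevMPS f θ⟧ : NonTriv 1 NF) ∈ locus 1 NF 0 := by
  refine ⟨kitaevMPS f θ, fun h => ?_, rfl⟩
  have := congrFun (congrFun h (0, 0)) (0, 0)
  simp [kitaevMPS, kitaevMatrices, parity_zero, kitaevCoeff_zero] at this

/-- The gauge class of the Kitaev family at phase `θ`, in the locus where the vacuum matrix is
non-zero. -/
def kitaevPoint {NF : ℕ} (f : Fin NF) (θ : ℝ) : locus 1 NF 0 :=
  ⟨⟦kitaevMPS f θ⟧, kitaevMPS_mem_locus f θ⟩

lemma continuous_kitaevPoint {NF : ℕ} (f : Fin NF) : Continuous (kitaevPoint f) := by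
  refine Continuous.subtype_mk (continuous_quotient_mk'.comp (Continuous.subtype_mk ?_ _)) _
  refine continuous_pi fun i => continuous_pi fun a => continuous_pi fun b => ?_
  have hc : Continuous fun θ : ℝ => kitaevCoeff f θ i := by
    unfold kitaevCoeff
    split_ifs <;> fun_prop
  simp only [kitaevMatrices, Matrix.kroneckerMap_apply, Matrix.smul_apply, smul_eq_mul]
  fun_prop

lemma wordProd_conj {NF L n : ℕ} (Z : BondMatrix n) (hZ : Z * Z = 1) (A : Occ NF → BondMatrix n)
    (w : Fin L → Occ NF) :
    wordProd (fun i => Z * A i * Z) w = Z * wordProd A w * Z := by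
  unfold wordProd
  induction L with
  | zero => simp [hZ]
  | succ L ih =>
    rw [List.ofFn_succ, List.ofFn_succ, List.prod_cons, List.prod_cons, ih]
    simp only [mul_assoc]
    rw [← mul_assoc Z Z, hZ, one_mul]

lemma kitaevPoint_two_pi {NF : ℕ} (f : Fin NF) :
    kitaevPoint f (2 * Real.pi) = kitaevPoint f 0 := by
  refine Subtype.ext (Quotient.sound fun L => ⟨1, by simp, ?_⟩)
  set Z : BondMatrix 1 := sigmaZ ⊗ₖ (1 : Matrix (Fin 1) (Fin 1) ℂ) with hZdef
  have hZ : Z * Z = 1 := by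
    rw [hZdef, ← Matrix.mul_kronecker_mul, sigmaZ_sq, one_mul, Matrix.one_kronecker_one]
  have hA : kitaevMatrices f (2 * Real.pi) = fun i => Z * kitaevMatrices f 0 i * Z := by
    funext i
    rw [kitaevMatrices, kitaevMatrices, ← grading_kronecker, ← Matrix.kronecker_smul, smul_smul]
    congr 2
    unfold kitaevCoeff
    split_ifs with h h'
    · simp [h, parity_zero]
    · have : Complex.I * ((2 * Real.pi : ℝ) : ℂ) / 2 = Real.pi * Complex.I := by
        push_cast
        ring
      rw [this, Complex.exp_pi_mul_I, h', parity_single]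
      simp [ZMod.val_one, neg_div]
    · simp
  funext w
  simp only [one_smul, state, kitaevMPS, one_mul, hA, wordProd_conj Z hZ]
  rw [Matrix.trace_mul_comm, ← mul_assoc, hZ, one_mul]

/-- The loop `θ ∈ [0, 2π]` (reparametrized by `θ = 2πt`) of Kitaev families, in the locus where
the vacuum matrix is non-zero. -/
def kitaevLoop {NF : ℕ} (f : Fin NF) : Path (kitaevPoint f 0) (kitaevPoint f 0) where
  toFun t := kitaevPoint f (2 * Real.pi * (t : ℝ))
  continuous_toFun := (continuous_kitaevPoint f).comp (by fun_prop)
  source' := by simp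
  target' := by simpa using kitaevPoint_two_pi f

/-- The same loop in the whole gauge-quotiented space. -/
def kitaevLoopFull {NF : ℕ} (f : Fin NF) :
    Path (kitaevPoint f 0 : NonTriv 1 NF) (kitaevPoint f 0 : NonTriv 1 NF) :=
  (kitaevLoop f).map continuous_subtype_val

/-! ### The Kitaev Hamiltonian on the fermionic Fock space -/

/-- Matrix of the annihilation operator `a_{k,g}` in the occupation basis
`∏_k ∏_g (a†_{k,g})^{i_{k,g}} |0⟩`, with the modes ordered lexicographically. -/
def annihilation {L NF : ℕ} (k : Fin L) (g : Fin NF) :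
    Matrix (Fin L → Occ NF) (Fin L → Occ NF) ℂ :=
  Matrix.of fun s t =>
    if t k g = 1 ∧ s = Function.update t k (Function.update (t k) g 0) then
      (-1 : ℂ) ^ (Finset.univ.filter fun m : Fin L × Fin NF =>
        (m.1 < k ∨ (m.1 = k ∧ m.2 < g)) ∧ t m.1 m.2 = 1).card
    else 0

/-- `a_{k+1,g}` with the anti-periodic convention `a_{L+1,g} = -a_{1,g}`. -/
def annihilationNext {L NF : ℕ} (k : Fin L) (g : Fin NF) :
    Matrix (Fin L → Occ NF) (Fin L → Occ NF) ℂ :=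
  (if (k : ℕ) + 1 = L then (-1 : ℂ) else 1) • annihilation (finRotate L k) g

/-- The Kitaev chain in flavor `f` with gap phase `θ` on an anti-periodic chain of length `L`,
`H(θ) = -∑_j (a†_{j+1} a_j + e^{iθ} a_{j+1} a_j + h.c.)`, all the other flavors being in the
trivial phase, with Hamiltonian `∑_j a†_j a_j`. -/
def kitaevHamiltonian {NF : ℕ} (f : Fin NF) (L : ℕ) (θ : ℝ) :
    Matrix (Fin L → Occ NF) (Fin L → Occ NF) ℂ :=
  -∑ k : Fin L,
      (((annihilationNext k f).conjTranspose * annihilation k f +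
          Complex.exp (Complex.I * θ) • (annihilationNext k f * annihilation k f)) +
        ((annihilationNext k f).conjTranspose * annihilation k f +
          Complex.exp (Complex.I * θ) •
            (annihilationNext k f * annihilation k f)).conjTranspose) +
    ∑ g ∈ Finset.univ.erase f, ∑ k : Fin L, (annihilation k g).conjTranspose * annihilation k g

/-- `ψ` is a ground state of `H`: a non-zero eigenvector for the lowest energy. -/
def IsGroundState {ι : Type*} [Fintype ι] (H : Matrix ι ι ℂ) (ψ : ι → ℂ) : Prop :=
  ψ ≠ 0 ∧ ∃ E : ℝ, H.mulVec ψ = (E : ℂ) • ψ ∧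
    ∀ φ : ι → ℂ, E * (star φ ⬝ᵥ φ).re ≤ (star φ ⬝ᵥ H.mulVec φ).re

end FMPS

end

noncomputable section

namespace FMPS

/-! ### Fundamental groups and open covers -/

/-! Up to a unitary, a family is `σ_x^{|i|} b^i`, that is, a pair `(u, v)` of non-zero complex
vectors: the even and the odd amplitudes. Since `σ_x` is traceless, a trace along a word is twice
the product of its amplitudes if the word is even, and zero otherwise. Words of length one fix `u`
up to a phase `c`. Words of length two force their phase to be `c²`, so `v` is fixed up to `±c`.
Hence `M` is the set of such pairs modulo `(u, v) ∼ (cu, ±cv)` with `c ∈ ℂˣ`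
(`gaugeEquiv_coeffMatrices_iff`, `Amp.toNonTriv_eq_iff`). The topologies agree as well, because
amplitudes can be recovered continuously from matrices near a given family, up to the sign of `v`
(`isOpenQuotientMap_toNonTriv`).

Over `M_p` the amplitude `u_p` is non-zero. Its phase absorbs `c`, and the other even amplitudes
contract linearly to zero. What survives is the direction of `v` up to sign, a point of the sphere
in `ℂ^{2^{NF-1}}` modulo `±1`, that is, of `ℝP^{2^{NF}-1}` (`locusHomotopyEquiv`). Its fundamental
group has order two, because the sphere is simply connected and covers it with deck group `±1`.

The loci `M_p`, `p` even, are an open cover of `M` with path connected pairwise intersections and a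
common base point, the class with all amplitudes equal to one. By a weak van Kampen argument,
`π₁(M)` is generated by the groups `π₁(M_p)`. All of these are generated by one and the same loop,
the rotation of `v` by a half turn, so `π₁(M)` is generated by a class of order at most two. This
class is non-trivial: `(u, v) ↦ v ⊗ ū` is well defined up to a non-zero real factor, so it maps `M`
to a projective space, and there the rotated loop lifts to a path between antipodes
(`not_homotopic_refl_of_twist`). The Kitaev loop is a half turn of the same kind, hence a generator.

For the ground states, each bond term plus its adjoint permutes the occupation basis up to phases,
so its expectation value is at most the squared norm. The Kitaev state is fixed by all `L` of them
and contains no other flavor, so it attains the lower bound `-L` of the energy. -/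

open Path.Homotopic unitInterval in
/-- A weak van Kampen theorem: if `X` is covered by open sets containing a common base point with
path connected pairwise intersections, then its fundamental group is generated by the loops lying
in one of the open sets. -/
theorem subgroup_eq_top_of_open_cover {X ι : Type*} [TopologicalSpace X] {U : ι → Set X}
    (hU : ∀ i, IsOpen (U i)) (hcov : ∀ x, ∃ i, x ∈ U i) {x₀ : X} (hx₀ : ∀ i, x₀ ∈ U i)
    (hpc : ∀ i j, IsPathConnected (U i ∩ U j)) (H : Subgroup (FundamentalGroup X x₀))
    (hH : ∀ i (γ : Path x₀ x₀), (∀ t, γ t ∈ U i) →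
      FundamentalGroup.fromPath (Path.Homotopic.Quotient.mk γ) ∈ H) : H = ⊤ := by
  have trans_cancel : ∀ {a b c d : X} (p : Path.Homotopic.Quotient a b)
      (q : Path.Homotopic.Quotient a b) (r : Path.Homotopic.Quotient b c)
      (e : Path.Homotopic.Quotient a c) (k : Path.Homotopic.Quotient d c),
      (p.trans q.symm).trans (((q.trans r).trans e.symm).trans (e.trans k.symm)) =
        (p.trans r).trans k.symm := by
    intro a b c d p q r e k
    rw [Path.Homotopic.Quotient.trans_assoc (q.trans r),
      ← Path.Homotopic.Quotient.trans_assoc e.symm, Path.Homotopic.Quotient.symm_trans,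
      Path.Homotopic.Quotient.refl_trans, Path.Homotopic.Quotient.trans_assoc,
      ← Path.Homotopic.Quotient.trans_assoc q.symm, ← Path.Homotopic.Quotient.trans_assoc q.symm,
      Path.Homotopic.Quotient.symm_trans, Path.Homotopic.Quotient.refl_trans,
      Path.Homotopic.Quotient.trans_assoc]
  have loop_mem : ∀ i {y : X} (δ δ' : Path x₀ y), (∀ t, δ t ∈ U i) → (∀ t, δ' t ∈ U i) →
      FundamentalGroup.fromPath ((Path.Homotopic.Quotient.mk δ).trans (Path.Homotopic.Quotient.mk δ').symm) ∈ H := by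
    intro i y δ δ' h h'
    have := hH i (δ.trans δ'.symm) fun t => by
      have : (δ.trans δ'.symm) t ∈ Set.range (δ.trans δ'.symm) := ⟨t, rfl⟩
      rw [Path.trans_range, Path.symm_range] at this
      rcases this with ⟨s, hs⟩ | ⟨s, hs⟩
      · exact hs ▸ h s
      · exact hs ▸ h' s
    simpa using this
  rw [eq_top_iff]
  rintro g -
  obtain ⟨γ, rfl⟩ := Path.Homotopic.Quotient.mk_surjective g
  obtain ⟨t, ht0, htm, ⟨N, hN⟩, ht⟩ := exists_monotone_Icc_subset_open_cover_unitInterval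
    (c := fun i => γ ⁻¹' U i) (fun i => (hU i).preimage γ.continuous)
    (fun s _ => by simpa using hcov (γ s))
  -- The invariant of the induction along a Lebesgue subdivision: `γ` up to `t n`, closed up by any
  -- return path inside a single `U i`, lies in `H`.
  have key : ∀ n i (h0 : x₀ = γ 0) (δ : Path x₀ (γ (t n))), (∀ s, δ s ∈ U i) →
      FundamentalGroup.fromPath
        ((Path.Homotopic.Quotient.mk ((γ.subpath 0 (t n)).cast h0 rfl)).trans (Path.Homotopic.Quotient.mk δ).symm) ∈ H := by
    intro n
    induction n with
    | zero =>
      intro i h0 δ hδ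
      have e : Path.Homotopic.Quotient.mk ((γ.subpath 0 (t 0)).cast h0 rfl) =
          Path.Homotopic.Quotient.mk ((Path.refl x₀).cast rfl ((congrArg γ ht0).trans h0.symm)) := by
        congr 1
        ext s
        change γ (Set.Icc.convexComb 0 (t 0) s) = x₀
        rw [ht0, Set.Icc.convexComb_eq, ← h0]
      rw [e]
      exact loop_mem i _ δ (fun s => hx₀ i) hδ
    | succ n ih =>
      intro i h0 δ hδ
      obtain ⟨j, hj⟩ := ht n
      have hn : γ (t n) ∈ U j := hj ⟨le_rfl, htm n.le_succ⟩
      obtain ⟨α, hα⟩ := (hpc j j).joinedIn x₀ ⟨hx₀ j, hx₀ j⟩ _ ⟨hn, hn⟩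
      set β := γ.subpath (t n) (t (n + 1)) with hβ
      have hβU : ∀ s, β s ∈ U j := by
        intro s
        have : β s ∈ Set.range β := ⟨s, rfl⟩
        rw [hβ, Path.range_subpath_of_le _ _ _ (htm n.le_succ)] at this
        obtain ⟨r, hr, e⟩ := this
        exact e ▸ hj hr
      have hn' : γ (t (n + 1)) ∈ U j := hj ⟨htm n.le_succ, le_rfl⟩
      -- The return path `δ` runs in `U i` while the new piece `β` runs in `U j`. A path `ε` in the
      -- intersection splits the loop into a `U j`-loop and a `U i`-loop.
      obtain ⟨ε, hε⟩ := (hpc i j).joinedIn x₀ ⟨hx₀ i, hx₀ j⟩ (γ (t (n + 1)))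
        ⟨by simpa using hδ 1, hn'⟩
      have h1 := ih j h0 α (fun s => (hα s).1)
      have h2 := loop_mem j (α.trans β) ε (fun s => by
        have : (α.trans β) s ∈ Set.range (α.trans β) := ⟨s, rfl⟩
        rw [Path.trans_range] at this
        rcases this with ⟨r, hr⟩ | ⟨r, hr⟩
        · exact hr ▸ (hα r).1
        · exact hr ▸ hβU r) (fun s => (hε s).2)
      have h3 := loop_mem i ε δ (fun s => (hε s).1) hδ
      -- The product in `FundamentalGroup` concatenates in reverse order, so the factor traversed
      -- first stands last.
      have h4 := H.mul_mem (H.mul_mem h3 h2) h1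
      convert h4 using 1
      simp only [FundamentalGroup.mul_def]
      have e : Path.Homotopic.Quotient.mk ((γ.subpath 0 (t (n + 1))).cast h0 rfl) =
          (Path.Homotopic.Quotient.mk ((γ.subpath 0 (t n)).cast h0 rfl)).trans (Path.Homotopic.Quotient.mk β) := by
        rw [← Path.Homotopic.Quotient.mk_trans]
        refine (Path.Homotopic.Quotient.eq.2 ?_).symm
        exact Path.Homotopic.pathCast
          ⟨Path.Homotopy.subpathTransSubpath γ 0 (t n) (t (n + 1))⟩ h0 rfl
      rw [e]
      exact (trans_cancel _ _ _ _ _).symm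
  have hN1 : t N = 1 := hN N le_rfl
  have h0 : x₀ = γ 0 := γ.source.symm
  have h1 : γ (t N) = x₀ := by rw [hN1]; exact γ.target
  obtain ⟨i, -⟩ := hcov x₀
  have h := key N i h0 ((Path.refl x₀).cast rfl h1) fun s => hx₀ i
  convert h using 1
  change Path.Homotopic.Quotient.mk γ = _
  rw [← Path.Homotopic.Quotient.mk_symm, ← Path.Homotopic.Quotient.mk_trans]
  have : Path.Homotopic.Quotient.mk γ =
      Path.Homotopic.Quotient.mk (γ.trans (Path.refl _)) := by simp
  rw [this]
  congr 1
  ext s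
  rw [Path.trans_apply, Path.trans_apply]
  split_ifs with hs
  · change γ _ = γ (Set.Icc.convexComb 0 (t N) _)
    rw [hN1, Set.Icc.convexComb_zero_one]
  · rfl

/-- A space covered by simply connected open sets containing a common base point, with path
connected pairwise intersections, is simply connected. -/
theorem simplyConnectedSpace_of_open_cover {X ι : Type*} [TopologicalSpace X] {U : ι → Set X}
    (hU : ∀ i, IsOpen (U i)) (hcov : ∀ x, ∃ i, x ∈ U i) {x₀ : X} (hx₀ : ∀ i, x₀ ∈ U i)
    (hpc : ∀ i j, IsPathConnected (U i ∩ U j)) (hs : ∀ i, SimplyConnectedSpace (U i)) :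
    SimplyConnectedSpace X := by
  have hX : PathConnectedSpace X := by
    have hj : ∀ x, Joined x₀ x := fun x => by
      obtain ⟨i, hi⟩ := hcov x
      exact ((hpc i i).joinedIn x₀ ⟨hx₀ i, hx₀ i⟩ x ⟨hi, hi⟩).joined
    exact ⟨⟨x₀⟩, fun x y => (hj x).symm.trans (hj y)⟩
  have hbot : (⊥ : Subgroup (FundamentalGroup X x₀)) = ⊤ := by
    refine subgroup_eq_top_of_open_cover hU hcov hx₀ hpc ⊥ fun i γ hγ => ?_
    let δ : Path (⟨x₀, hx₀ i⟩ : U i) ⟨x₀, hx₀ i⟩ :=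
      { toFun := fun t => ⟨γ t, hγ t⟩
        continuous_toFun := by fun_prop
        source' := by simp
        target' := by simp }
    have := hs i
    have h := (SimplyConnectedSpace.paths_homotopic δ (Path.refl _)).map
      (⟨Subtype.val, continuous_subtype_val⟩ : C(U i, X))
    exact Subgroup.mem_bot.2 (Path.Homotopic.Quotient.eq.2 h)
  have hsub : Subsingleton (FundamentalGroup X x₀) := by
    have := Subgroup.subsingleton_iff.1 (subsingleton_of_bot_eq_top hbot)
    exact this
  rw [simply_connected_iff_loops_nullhomotopic]
  refine ⟨hX, fun x γ => Path.Homotopic.Quotient.exact ?_⟩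
  have : Subsingleton (FundamentalGroup X x) :=
    (FundamentalGroup.fundamentalGroupMulEquivOfPathConnected x₀ x).symm.subsingleton
  exact Subsingleton.elim (α := FundamentalGroup X x) _ _

/-! ### Spheres and real projective spaces -/

section Sphere

variable {V : Type*} [NormedAddCommGroup V] [InnerProductSpace ℝ V]

/-- The set is the complement of the closed ray `ℝ≥0 n`. The segment from `-n` stays in it because
the inner product with `n` falls by exactly `a` while the norm falls by at most `a`. -/
lemma starConvex_inner_lt_norm {n : V} (hn : ‖n‖ = 1) :
    StarConvex ℝ (-n) {x : V | inner ℝ x n < ‖x‖} := by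
  rw [starConvex_iff_forall_pos (by simp [hn])]
  intro x hx a b ha hb hab
  simp only [Set.mem_ofPred_eq] at hx ⊢
  have h1 : ‖b • x‖ - ‖a • n‖ ≤ ‖a • -n + b • x‖ := by
    have := norm_sub_norm_le (b • x) (a • n)
    rwa [smul_neg, neg_add_eq_sub]
  rw [norm_smul, norm_smul, Real.norm_of_nonneg ha.le, Real.norm_of_nonneg hb.le, hn] at h1
  rw [inner_add_left, inner_smul_left, inner_smul_left, inner_neg_left,
    real_inner_self_eq_norm_sq, hn]
  simp only [conj_trivial]
  nlinarith

/-- By the equality case of Cauchy–Schwarz the set is the complement of the line `ℝn`, whose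
codimension exceeds one. -/
lemma isPathConnected_abs_inner_lt_norm {n : V} (hn : ‖n‖ = 1) (hV : 2 < Module.rank ℝ V) :
    IsPathConnected {x : V | |inner ℝ x n| < ‖x‖} := by
  have e : {x : V | |inner ℝ x n| < ‖x‖} = ((ℝ ∙ n : Submodule ℝ V) : Set V)ᶜ := by
    have hn0 : n ≠ 0 := by
      rintro rfl
      simp at hn
    ext x
    simp only [Set.mem_ofPred_eq, Set.mem_compl_iff, SetLike.mem_coe, Submodule.mem_span_singleton]
    constructor
    · rintro h ⟨r, rfl⟩
      rw [inner_smul_left, real_inner_self_eq_norm_sq, norm_smul, hn] at h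
      simp at h
    · intro h
      have hx0 : x ≠ 0 := by
        rintro rfl
        exact h ⟨0, by simp⟩
      refine lt_of_le_of_ne (by simpa [hn] using abs_real_inner_le_norm x n) fun he => h ?_
      have := (norm_inner_eq_norm_iff (𝕜 := ℝ) hn0 hx0).1
        (by rw [real_inner_comm, Real.norm_eq_abs, he, hn, one_mul])
      obtain ⟨r, -, hr⟩ := this
      exact ⟨r, hr.symm⟩
  rw [e]
  refine isPathConnected_compl_of_one_lt_codim ?_
  by_contra hc
  push Not at hc
  have h1 := Submodule.rank_quotient_add_rank (ℝ ∙ n : Submodule ℝ V)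
  have h2 : Module.rank ℝ (ℝ ∙ n : Submodule ℝ V) ≤ 1 := by
    simpa using rank_span_le (R := ℝ) ({n} : Set V)
  have : Module.rank ℝ V ≤ 2 := by
    rw [← h1]
    exact (add_le_add hc h2).trans (by norm_num)
  exact absurd hV this.not_gt

/-- The unit sphere of a real inner product space of dimension at least `3` is simply connected. -/
theorem simplyConnectedSpace_sphere (hV : 2 < Module.rank ℝ V) :
    SimplyConnectedSpace (Metric.sphere (0 : V) 1) := by
  have : Nontrivial V := by
    rw [← rank_pos_iff_nontrivial (R := ℝ)]
    exact lt_trans (by norm_num) hV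
  obtain ⟨n, hn⟩ := exists_norm_eq V (zero_le_one' ℝ)
  -- The argument is run in `V ∖ {0}`, covered by the complements of two opposite rays. Each is star
  -- convex, and they meet in the complement of a line.
  let U : ℤˣ → Set {x : V // x ≠ 0} := fun s => {x | inner ℝ x.1 (((s : ℤ) : ℝ) • n) < ‖x.1‖}
  have hs : ∀ s : ℤˣ, ‖((s : ℤ) : ℝ) • n‖ = 1 := fun s => by
    rcases Int.units_eq_one_or s with rfl | rfl <;> simp [hn]
  have hne : ∀ m : V, ∀ x : V, inner ℝ x m < ‖x‖ → x ≠ 0 := by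
    rintro m x h rfl
    simp at h
  have hlift : ∀ (A : Set V) (hA : IsPathConnected A) (h0 : ∀ x ∈ A, x ≠ 0),
      IsPathConnected (((↑) : {x : V // x ≠ 0} → V) ⁻¹' A) := by
    intro A hA h0
    refine Topology.IsInducing.subtypeVal.isPathConnected_iff.2 ?_
    convert hA
    ext x
    constructor
    · rintro ⟨y, hy, rfl⟩
      exact hy
    · intro hx
      exact ⟨⟨x, h0 x hx⟩, hx, rfl⟩
  have habs := isPathConnected_abs_inner_lt_norm hn hV
  obtain ⟨x₀, hx₀⟩ := habs.nonempty
  have hx₀U : ∀ s : ℤˣ, inner ℝ x₀ (((s : ℤ) : ℝ) • n) < ‖x₀‖ := by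
    intro s
    have := abs_lt.1 (Set.mem_ofPred_eq.mp hx₀)
    rcases Int.units_eq_one_or s with rfl | rfl
    · simpa using this.2
    · simp only [Units.val_neg, Units.val_one, Int.cast_neg, Int.cast_one, neg_smul, one_smul,
        inner_neg_right]
      linarith
  have hUpc : ∀ s, IsPathConnected (U s) := fun s =>
    hlift {x : V | inner ℝ x (((s : ℤ) : ℝ) • n) < ‖x‖}
      ((starConvex_inner_lt_norm (hs s)).isPathConnected
        (by rw [Set.mem_ofPred_eq, norm_neg, hs, inner_neg_left, real_inner_self_eq_norm_sq, hs]
            norm_num)) (hne _)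
  have hP : SimplyConnectedSpace {x : V // x ≠ 0} := by
    refine simplyConnectedSpace_of_open_cover (U := U) (x₀ := ⟨x₀, hne _ _ (hx₀U 1)⟩)
      (fun s => isOpen_lt (by fun_prop) (by fun_prop)) (fun x => ?_) (fun s => hx₀U s) (fun s t => ?_)
      fun s => ?_
    · by_contra hc
      push Not at hc
      have h1 := hc 1
      have h2 := hc (-1)
      simp only [U, Set.mem_ofPred_eq, not_lt, Units.val_neg, Units.val_one, Int.cast_neg,
        Int.cast_one, neg_smul, one_smul, inner_neg_right] at h1 h2
      have := norm_pos_iff.2 x.2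
      linarith
    · by_cases hst : s = t
      · rw [hst, Set.inter_self]
        exact hUpc t
      · convert hlift _ habs (fun x hx => by
          rintro rfl
          simp at hx) using 1
        ext x
        rcases Int.units_eq_one_or s with rfl | rfl <;>
        rcases Int.units_eq_one_or t with rfl | rfl
        · exact absurd rfl hst
        · simp [U, abs_lt, and_comm, neg_lt, Set.mem_inter_iff]
        · simp [U, abs_lt, neg_lt]
        · exact absurd rfl hst
    · have hc : ContractibleSpace {x : V | inner ℝ x (((s : ℤ) : ℝ) • n) < ‖x‖} :=
        (starConvex_inner_lt_norm (hs s)).contractibleSpace ⟨x₀, hx₀U s⟩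
      let φ : U s ≃ₜ {x : V | inner ℝ x (((s : ℤ) : ℝ) • n) < ‖x‖} :=
        { toFun := fun x => ⟨x.1.1, x.2⟩
          invFun := fun x => ⟨⟨x.1, hne _ _ x.2⟩, x.2⟩
          left_inv := fun x => rfl
          right_inv := fun x => rfl
          continuous_toFun := by fun_prop
          continuous_invFun := by fun_prop }
      have := φ.contractibleSpace
      infer_instance
  rw [simply_connected_iff_paths_homotopic']
  have hSpc : PathConnectedSpace (Metric.sphere (0 : V) 1) :=
    isPathConnected_iff_pathConnectedSpace.1
      (isPathConnected_sphere (lt_trans (by norm_num) hV) 0 zero_le_one)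
  refine ⟨hSpc, fun {x y} p q => ?_⟩
  -- The sphere is a retract of the punctured space, so homotopies there are pushed back by the
  -- radial retraction.
  have hS0 : ∀ x : Metric.sphere (0 : V) 1, x.1 ≠ 0 := fun x => ne_zero_of_mem_unit_sphere x
  let i : C(Metric.sphere (0 : V) 1, {x : V // x ≠ 0}) := ⟨fun x => ⟨x.1, hS0 x⟩, by fun_prop⟩
  let r : C({x : V // x ≠ 0}, Metric.sphere (0 : V) 1) :=
    ⟨fun x => ⟨‖x.1‖⁻¹ • x.1, by simp [norm_smul, x.2]⟩, by
      refine Continuous.subtype_mk (Continuous.smul (Continuous.inv₀ (by fun_prop)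
        fun x => norm_ne_zero_iff.2 x.2) (by fun_prop)) _⟩
  have hri : ∀ x, r (i x) = x := fun x => Subtype.ext (by simp [r, i])
  have h := ((SimplyConnectedSpace.paths_homotopic (p.map i.continuous)
    (q.map i.continuous)).map r).pathCast (hri x).symm (hri y).symm
  convert h using 1 <;> ext t <;> exact congrArg Subtype.val (hri _).symm

end Sphere

/-- Antipodal identification as orbits of a group of order two, so that the quotient is a covering
with deck group `ℤˣ`. -/
instance unitsSMulSphere (d : ℕ) :
    MulAction ℤˣ (Metric.sphere (0 : EuclideanSpace ℝ (Fin (d + 1))) 1) where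
  smul s x := ⟨((s : ℤ) : ℝ) • x.1, by
    rcases Int.units_eq_one_or s with rfl | rfl <;> simp⟩
  one_smul x := Subtype.ext (by
    change (((1 : ℤˣ) : ℤ) : ℝ) • x.1 = x.1
    simp)
  mul_smul s t x := Subtype.ext (by
    change (((s * t : ℤˣ) : ℤ) : ℝ) • x.1 = ((s : ℤ) : ℝ) • ((t : ℤ) : ℝ) • x.1
    simp [smul_smul])

lemma neg_one_smul_sphere {d : ℕ} (x : Metric.sphere (0 : EuclideanSpace ℝ (Fin (d + 1))) 1) :
    (-1 : ℤˣ) • x = -x :=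
  Subtype.ext (by
    change (((-1 : ℤˣ) : ℤ) : ℝ) • x.1 = -x.1
    simp)

/-- The quotient map from the sphere to real projective space. -/
def toRP (d : ℕ) : Metric.sphere (0 : EuclideanSpace ℝ (Fin (d + 1))) 1 → RP d := Quotient.mk _

lemma toRP_eq_iff {d : ℕ} {x y : Metric.sphere (0 : EuclideanSpace ℝ (Fin (d + 1))) 1} :
    toRP d x = toRP d y ↔ x = y ∨ x = -y :=
  Quotient.eq

lemma isQuotientCoveringMap_toRP (d : ℕ) : IsQuotientCoveringMap (toRP d) ℤˣ where
  toIsQuotientMap := isQuotientMap_quotient_mk'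
  continuous_const_smul s := by
    refine Continuous.subtype_mk (f := fun x : Metric.sphere (0 : EuclideanSpace ℝ (Fin (d + 1))) 1
      => ((s : ℤ) : ℝ) • x.1) (by fun_prop) _
  apply_eq_iff_mem_orbit := by
    intro x y
    rw [toRP_eq_iff]
    constructor
    · rintro (rfl | rfl)
      · exact ⟨1, one_smul _ _⟩
      · exact ⟨-1, neg_one_smul_sphere y⟩
    · rintro ⟨s, rfl⟩
      rcases Int.units_eq_one_or s with rfl | rfl
      · exact Or.inl (one_smul _ _)
      · exact Or.inr (neg_one_smul_sphere y)
  disjoint x := by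
    -- If `y` and `-y` were both within distance one of `x`, then `2x = -(y - x) - (-y - x)` would
    -- have norm less than two.
    refine ⟨Metric.ball x 1, Metric.ball_mem_nhds x one_pos, ?_⟩
    rintro s ⟨_, ⟨y, hy, rfl⟩, hy'⟩
    rcases Int.units_eq_one_or s with rfl | rfl
    · rfl
    · simp only [neg_one_smul_sphere] at hy'
      rw [Metric.mem_ball, Subtype.dist_eq, dist_eq_norm] at hy hy'
      have h1 : ‖((2 : ℝ) • x.1 : EuclideanSpace ℝ (Fin (d + 1)))‖ = 2 := by
        rw [norm_smul, norm_eq_of_mem_sphere]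
        norm_num
      have h2 : (2 : ℝ) • x.1 = -((y : EuclideanSpace ℝ (Fin (d + 1))) - x) -
          (((-y : Metric.sphere (0 : EuclideanSpace ℝ (Fin (d + 1))) 1) :
            EuclideanSpace ℝ (Fin (d + 1))) - x) := by
        rw [coe_neg_sphere]
        module
      have h3 := norm_sub_le (-((y : EuclideanSpace ℝ (Fin (d + 1))) - x))
        (((-y : Metric.sphere (0 : EuclideanSpace ℝ (Fin (d + 1))) 1) :
            EuclideanSpace ℝ (Fin (d + 1))) - x)
      rw [← h2, h1, norm_neg] at h3
      linarith

/-- The fundamental group of `ℝP^d`, for `d ≥ 2`, has order two. -/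
theorem card_fundamentalGroup_RP {d : ℕ} (hd : 2 ≤ d) (x : RP d) :
    Nat.card (FundamentalGroup (RP d) x) = 2 := by
  have : SimplyConnectedSpace (Metric.sphere (0 : EuclideanSpace ℝ (Fin (d + 1))) 1) := by
    refine simplyConnectedSpace_sphere ?_
    rw [rank_eq_card_basis (EuclideanSpace.basisFun (Fin (d + 1)) ℝ).toBasis, Fintype.card_fin]
    exact_mod_cast Nat.lt_of_lt_of_le (by norm_num) (Nat.succ_le_succ hd)
  obtain ⟨e, he⟩ := (isQuotientCoveringMap_toRP d).surjective x
  rw [Nat.card_congr ((isQuotientCoveringMap_toRP d).fundamentalGroupEquiv ⟨e, he⟩).toEquiv,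
    ← Nat.card_congr MulOpposite.opEquiv]
  simp

/-- A loop whose image in real projective space lifts to a path in the sphere that is not closed
is not null-homotopic. -/
theorem not_homotopic_refl_of_lift {M : Type*} [TopologicalSpace M] {d : ℕ} (φ : C(M, RP d))
    {x : M} (γ : Path x x)
    (Γ : C(unitInterval, Metric.sphere (0 : EuclideanSpace ℝ (Fin (d + 1))) 1))
    (hΓ : ∀ t, toRP d (Γ t) = φ (γ t)) (hne : Γ 1 ≠ Γ 0) : ¬ γ.Homotopic (Path.refl x) := by
  intro h
  have cov := (isQuotientCoveringMap_toRP d).isCoveringMap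
  have h' := h.map φ
  have e0 : φ x = toRP d (Γ 0) := by rw [hΓ, γ.source]
  have := cov.liftPath_apply_one_eq_of_homotopicRel h' (Γ 0) (by simp [hΓ]) (by simp [hΓ])
  -- Both `Γ` and the constant map at `Γ 0` are recognized as the lifts of the two homotopic loops,
  -- so their endpoints must agree.
  have h1 := (cov.eq_liftPath_iff' (γ := (γ.map φ.continuous).toContinuousMap) (e := Γ 0)
    (by simp [hΓ])).2 (⟨by ext t; simp [hΓ], rfl⟩ : toRP d ∘ Γ = _ ∧ _)
  have h2 := (cov.eq_liftPath_iff' (γ := ((Path.refl x).map φ.continuous).toContinuousMap)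
    (e := Γ 0) (by simp [hΓ])).2
    (⟨by ext t; simp [e0], rfl⟩ : toRP d ∘ (ContinuousMap.const _ (Γ 0)) = _ ∧ _)
  rw [← h1, ← h2] at this
  exact hne this

/-- A homotopy equivalence induces isomorphisms of fundamental groups. -/
def fundamentalGroupEquivOfHomotopyEquiv {X Y : Type*} [TopologicalSpace X] [TopologicalSpace Y]
    (e : X ≃ₕ Y) (x : X) : FundamentalGroup X x ≃* FundamentalGroup Y (e x) :=
  (FundamentalGroupoidFunctor.equivOfHomotopyEquiv e).fullyFaithfulFunctor.mulEquivEnd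
    (FundamentalGroupoid.mk x)

lemma nonempty_mulEquiv_zmod_two {G : Type*} [Group G] (h : Nat.card G = 2) :
    Nonempty (G ≃* Multiplicative (ZMod 2)) :=
  have : Fact (Nat.Prime 2) := ⟨Nat.prime_two⟩
  ⟨mulEquivOfPrimeCardEq (p := 2) h (by simp)⟩

lemma zpowers_eq_top_of_card_two {G : Type*} [Group G] (h : Nat.card G = 2) {g : G} (hg : g ≠ 1) :
    Subgroup.zpowers g = ⊤ :=
  have : Fact (Nat.Prime 2) := ⟨Nat.prime_two⟩
  zpowers_eq_top_of_prime_card h hg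

/-! ### Families of bond dimension two as vectors of coefficients -/

lemma zmod_two_eq (s : ZMod 2) : s = 0 ∨ s = 1 := by
  revert s
  decide

lemma sigmaX_pow_val_add (s t : ZMod 2) :
    sigmaX ^ s.val * sigmaX ^ t.val = sigmaX ^ (s + t).val := by
  rcases zmod_two_eq s with rfl | rfl <;> rcases zmod_two_eq t with rfl | rfl
  · simp
  · simp
  · simp
  · rw [show (1 + 1 : ZMod 2) = 0 from rfl]
    simp [ZMod.val_one, sigmaX_sq]

/-- The matrices `A^i = σ_x^{|i|} b^i`. -/
def coeffMatrices {NF : ℕ} (b : Occ NF → ℂ) (i : Occ NF) : BondMatrix 1 :=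
  (sigmaX ^ (parity i).val) ⊗ₖ (b i • (1 : Matrix (Fin 1) (Fin 1) ℂ))

lemma coeffMatrices_eq_smul {NF : ℕ} (b : Occ NF → ℂ) (i : Occ NF) :
    coeffMatrices b i =
      b i • ((sigmaX ^ (parity i).val) ⊗ₖ (1 : Matrix (Fin 1) (Fin 1) ℂ)) := by
  rw [coeffMatrices, Matrix.kronecker_smul]

lemma wordProd_coeffMatrices {NF L : ℕ} (b : Occ NF → ℂ) (w : Fin L → Occ NF) :
    wordProd (coeffMatrices b) w =
      (∏ k, b (w k)) • ((sigmaX ^ (∑ k, parity (w k)).val) ⊗ₖ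
        (1 : Matrix (Fin 1) (Fin 1) ℂ)) := by
  unfold wordProd
  induction L with
  | zero => simp
  | succ L ih =>
    rw [List.ofFn_succ, List.prod_cons, ih, coeffMatrices_eq_smul, Fin.prod_univ_succ,
      Fin.sum_univ_succ, smul_mul_smul_comm, ← Matrix.mul_kronecker_mul, sigmaX_pow_val_add,
      one_mul]

lemma trace_sigmaX_pow (s : ZMod 2) : (sigmaX ^ s.val).trace = if s = 0 then 2 else 0 := by
  rcases zmod_two_eq s with rfl | rfl
  · simp
  · simp [ZMod.val_one, sigmaX, Matrix.trace]

/-- An odd word multiplies to a multiple of the traceless `σ_x`, so gauge data is visible only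
through products of amplitudes of even total parity. -/
lemma state_coeffMatrices {NF : ℕ} (b : Occ NF → ℂ) (L : ℕ) (w : Fin L → Occ NF) :
    state 1 (coeffMatrices b) L w =
      if ∑ k, parity (w k) = 0 then 2 * ∏ k, b (w k) else 0 := by
  rw [state, one_mul, wordProd_coeffMatrices, Matrix.trace_smul, Matrix.trace_kronecker,
    trace_sigmaX_pow]
  split_ifs <;> simp [mul_comm]

lemma wordProd_unitary_conj {NF L : ℕ} {m : Type*} [Fintype m] [DecidableEq m]
    {W : Matrix m m ℂ} (hW : W ∈ Matrix.unitaryGroup m ℂ)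
    (A : Occ NF → Matrix m m ℂ) (w : Fin L → Occ NF) :
    wordProd (fun i => W * A i * star W) w = W * wordProd A w * star W := by
  have h1 := Matrix.mem_unitaryGroup_iff.1 hW
  have h2 := Matrix.mem_unitaryGroup_iff'.1 hW
  unfold wordProd
  induction L with
  | zero => simp [h1]
  | succ L ih =>
    rw [List.ofFn_succ, List.ofFn_succ, List.prod_cons, List.prod_cons, ih]
    simp only [mul_assoc]
    rw [← mul_assoc (star W) W, h2, one_mul]

lemma state_unitary_conj {NF : ℕ} {W : BondMatrix 1}
    (hW : W ∈ Matrix.unitaryGroup (Fin 2 × Fin 1) ℂ) (A : Occ NF → BondMatrix 1) (L : ℕ) :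
    state 1 (fun i => W * A i * star W) L = state 1 A L := by
  have h2 := Matrix.mem_unitaryGroup_iff'.1 hW
  funext w
  rw [state, state, one_mul, one_mul, wordProd_unitary_conj hW, Matrix.trace_mul_comm,
    ← mul_assoc, h2, one_mul]

/-- The vectors of coefficients of injective families in canonical form. -/
structure IsCoeff {NF : ℕ} (b : Occ NF → ℂ) : Prop where
  even : ∃ i, parity i = 0 ∧ b i ≠ 0
  odd : ∃ i, parity i = 1 ∧ b i ≠ 0
  sum : ∑ i, ‖b i‖ ^ 2 = 1

/-- `σ_x` is unitary, so the canonical form of the matrices is just the normalization of the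
coefficient vector. -/
lemma coeffMatrices_mul_star {NF : ℕ} (b : Occ NF → ℂ) (i : Occ NF) :
    coeffMatrices b i * star (coeffMatrices b i) = ((‖b i‖ ^ 2 : ℝ) : ℂ) • (1 : BondMatrix 1) := by
  have hX : sigmaX ^ (parity i).val * star (sigmaX ^ (parity i).val) = 1 := by
    rcases zmod_two_val (parity i) with h | h <;> rw [h]
    · simp
    · rw [pow_one, sigmaX_star, sigmaX_sq]
  rw [coeffMatrices, Matrix.star_eq_conjTranspose, Matrix.conjTranspose_kronecker,
    ← Matrix.mul_kronecker_mul, ← Matrix.star_eq_conjTranspose, hX]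
  simp [smul_smul, Matrix.kronecker_smul, ← Complex.mul_conj', mul_comm]

lemma isFMPS_coeffMatrices {NF : ℕ} (b : Occ NF → ℂ) : IsFMPS 1 (coeffMatrices b) :=
  ⟨sigmaZ ⊗ₖ 1, ⟨1, one_mem _, by simp⟩, fun _ => grading_kronecker _ _⟩

lemma IsCoeff.isInjectiveMinus {NF : ℕ} {b : Occ NF → ℂ} (hb : IsCoeff b) :
    IsInjectiveMinus 1 (coeffMatrices b) := by
  refine ⟨1, one_mem _, fun i => b i • 1, fun i => by simp [coeffMatrices], 2, fun s => ?_⟩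
  obtain ⟨i, hi, h0⟩ := hb.even
  obtain ⟨j, hj, h1⟩ := hb.odd
  rcases zmod_two_eq s with rfl | rfl
  · refine span_eq_top_of_mem (mul_ne_zero h0 h0) ⟨![i, i], ?_, ?_⟩
    · simp [hi]
    · simp [wordProd, smul_smul]
  · refine span_eq_top_of_mem (mul_ne_zero h0 h1) ⟨![i, j], ?_, ?_⟩
    · simp [hi, hj]
    · simp [wordProd, smul_smul, mul_comm]

lemma IsCoeff.isCanonical {NF : ℕ} {b : Occ NF → ℂ} (hb : IsCoeff b) :
    IsCanonical 1 (coeffMatrices b) := by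
  rw [IsCanonical, Finset.sum_congr rfl fun i _ => coeffMatrices_mul_star b i, ← Finset.sum_smul,
    ← Complex.ofReal_sum, hb.sum]
  simp

/-- The family with given coefficients. -/
def IsCoeff.family {NF : ℕ} {b : Occ NF → ℂ} (hb : IsCoeff b) : NonTrivTilde 1 NF :=
  ⟨coeffMatrices b, isFMPS_coeffMatrices b, hb.isInjectiveMinus, hb.isCanonical⟩

/-- A set spanning the non-zero space `M_1(ℂ)` contains a non-zero product, and no factor of that
product can vanish. -/
lemma exists_word_ne_zero {NF l : ℕ} {B : Occ NF → Matrix (Fin 1) (Fin 1) ℂ} {s : ZMod 2}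
    (h : Submodule.span ℂ {M : Matrix (Fin 1) (Fin 1) ℂ |
      ∃ w : Fin l → Occ NF, ∑ k, parity (w k) = s ∧ M = wordProd B w} = ⊤) :
    ∃ w : Fin l → Occ NF, ∑ k, parity (w k) = s ∧ ∀ k, B (w k) ≠ 0 := by
  by_contra hc
  push Not at hc
  have hbot : Submodule.span ℂ {M : Matrix (Fin 1) (Fin 1) ℂ |
      ∃ w : Fin l → Occ NF, ∑ k, parity (w k) = s ∧ M = wordProd B w} = ⊥ := by
    rw [Submodule.span_eq_bot]
    rintro M ⟨w, hw, rfl⟩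
    obtain ⟨k, hk⟩ := hc w hw
    exact List.prod_eq_zero ((List.mem_ofFn' _ _).2 ⟨k, hk⟩)
  exact bot_ne_top (hbot.symm.trans h)

/-- Every family is unitarily equivalent to one given by a vector of coefficients. -/
theorem exists_isCoeff {NF : ℕ} (A : NonTrivTilde 1 NF) :
    ∃ W ∈ Matrix.unitaryGroup (Fin 2 × Fin 1) ℂ, ∃ b : Occ NF → ℂ, IsCoeff b ∧
      A.1 = fun i => W * coeffMatrices b i * star W := by
  obtain ⟨A, -, ⟨W, hW, B, hA, l, hl⟩, hcan⟩ := A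
  have h1 := Matrix.mem_unitaryGroup_iff.1 hW
  have h2 := Matrix.mem_unitaryGroup_iff'.1 hW
  have hB : ∀ i, B i = B i 0 0 • 1 := fun i => by
    ext a c
    fin_cases a; fin_cases c
    simp
  have hB0 : ∀ i, B i ≠ 0 → B i 0 0 ≠ 0 := fun i h h' => h (by rw [hB i, h', zero_smul])
  have hA' : A = fun i => W * coeffMatrices (fun i => B i 0 0) i * star W := by
    funext i
    rw [hA i, coeffMatrices, ← hB i]
  refine ⟨W, hW, fun i => B i 0 0, ⟨?_, ?_, ?_⟩, hA'⟩
  -- Without even amplitudes every non-vanishing word of length `l` has parity `l mod 2`, so even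
  -- and odd words of the same length could not both span.
  · by_contra hc
    push Not at hc
    have hpar : ∀ w : Fin l → Occ NF, (∀ k, B (w k) ≠ 0) → ∑ k, parity (w k) = (l : ZMod 2) := by
      intro w hw
      rw [Finset.sum_congr rfl fun k _ =>
        (zmod_two_eq (parity (w k))).resolve_left fun h => hB0 _ (hw k) (hc _ h)]
      simp
    obtain ⟨w, hw, hne⟩ := exists_word_ne_zero (hl 0)
    obtain ⟨w', hw', hne'⟩ := exists_word_ne_zero (hl 1)
    rw [hpar w hne] at hw
    rw [hpar w' hne', hw] at hw'
    exact zero_ne_one hw'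
  · obtain ⟨w, hw, hne⟩ := exists_word_ne_zero (hl 1)
    by_contra hc
    push Not at hc
    rw [Finset.sum_eq_zero fun k _ =>
        (zmod_two_eq (parity (w k))).resolve_right fun h => hB0 _ (hne k) (hc _ h)] at hw
    exact zero_ne_one hw
  · have key : ∀ i, A i * star (A i) =
        ((‖B i 0 0‖ ^ 2 : ℝ) : ℂ) • (1 : BondMatrix 1) := by
      intro i
      have e : A i * star (A i) = W * (coeffMatrices (fun i => B i 0 0) i * (star W * W) *
          star (coeffMatrices (fun i => B i 0 0) i)) * star W := by
        rw [hA']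
        simp only [star_mul, star_star, mul_assoc]
      rw [e, h2, mul_one, coeffMatrices_mul_star, Matrix.mul_smul, Matrix.smul_mul, mul_one, h1]
    rw [IsCanonical, Finset.sum_congr rfl fun i _ => key i, ← Finset.sum_smul] at hcan
    have := congrFun (congrFun hcan (0, 0)) (0, 0)
    simp only [Matrix.smul_apply, Matrix.one_apply_eq, smul_eq_mul, mul_one,
      ← Complex.ofReal_sum] at this
    exact_mod_cast this

/-- Gauge equivalence in terms of the coefficients. -/
theorem gaugeEquiv_coeffMatrices_iff {NF : ℕ} {b b' : Occ NF → ℂ} (hb : IsCoeff b) :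
    GaugeEquiv (coeffMatrices b) (coeffMatrices b') ↔
      ∃ c : ℂ, ‖c‖ = 1 ∧ ∃ s : ℤˣ, (∀ i, parity i = 0 → b i = c * b' i) ∧
        ∀ i, parity i = 1 → b i = (s : ℤ) * c * b' i := by
  constructor
  · intro h
    obtain ⟨c, hc, h1⟩ := h 1
    obtain ⟨d, hd, h2⟩ := h 2
    have he : ∀ i, parity i = 0 → b i = c * b' i := by
      intro i hi
      have := congrFun h1 ![i]
      simp only [state_coeffMatrices, Pi.smul_apply, smul_eq_mul] at this
      simp only [Finset.univ_unique, Fin.default_eq_zero, Matrix.cons_val_fin_one,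
        Finset.sum_const, Finset.card_singleton, one_smul, hi, Finset.prod_singleton,
        if_true] at this
      linear_combination this / 2
    have h2' : ∀ i j, parity i + parity j = 0 → b i * b j = d * (b' i * b' j) := by
      intro i j hij
      have := congrFun h2 ![i, j]
      simp only [state_coeffMatrices, Pi.smul_apply, smul_eq_mul] at this
      simp [hij] at this
      linear_combination this / 2
    obtain ⟨i₀, hi₀, hb₀⟩ := hb.even
    obtain ⟨j, hj, hbj⟩ := hb.odd
    -- The word `i₀ i₀` with an even label compares the phases at lengths one and two.
    have hd' : d = c ^ 2 := by
      have hb₀' : b' i₀ ≠ 0 := by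
        intro h
        rw [he i₀ hi₀, h, mul_zero] at hb₀
        exact hb₀ rfl
      have := h2' i₀ i₀ (by simp [hi₀])
      rw [he i₀ hi₀] at this
      have h3 : (d - c ^ 2) * (b' i₀ * b' i₀) = 0 := by linear_combination -this
      exact sub_eq_zero.1 ((mul_eq_zero.1 h3).resolve_right (mul_ne_zero hb₀' hb₀'))
    have hodd : ∀ i, parity i = 1 → b i * b j = c ^ 2 * (b' i * b' j) := fun i hi => by
      rw [← hd']
      exact h2' i j (by rw [hi, hj]; rfl)
    -- Length two only sees products of two odd amplitudes, so one sign is undetermined. Pairing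
    -- with the fixed label `j` shows that it is common to all odd labels.
    have hsq : b j ^ 2 = (c * b' j) ^ 2 := by linear_combination hodd j hj
    obtain ⟨s, hs⟩ : ∃ s : ℤˣ, b j = (s : ℤ) * c * b' j := by
      rcases sq_eq_sq_iff_eq_or_eq_neg.1 hsq with h | h
      · exact ⟨1, by simpa using h⟩
      · exact ⟨-1, by simpa using h⟩
    refine ⟨c, hc, s, he, fun i hi => mul_right_cancel₀ hbj ?_⟩
    have hss : (((s : ℤ) : ℂ)) ^ 2 = 1 := by
      rcases Int.units_eq_one_or s with rfl | rfl <;> simp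
    rw [hodd i hi, hs]
    linear_combination -(c ^ 2 * b' i * b' j) * hss
  · rintro ⟨c, hc, s, he, ho⟩ L
    refine ⟨c ^ L, by simp [hc], ?_⟩
    funext w
    rw [Pi.smul_apply, state_coeffMatrices, state_coeffMatrices]
    split_ifs with hw
    · have h1 : ∀ k, b (w k) = (((s ^ (parity (w k)).val : ℤˣ) : ℤ) : ℂ) * (c * b' (w k)) := by
        intro k
        rcases zmod_two_eq (parity (w k)) with h | h
        · simp [h, he _ h]
        · simp [h, ho _ h, ZMod.val_one, mul_assoc]
      -- An even word contains an even number of odd letters, so the relative sign cancels.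
      have h2 : ∏ k, s ^ (parity (w k)).val = 1 := by
        rw [Finset.prod_pow_eq_pow_sum]
        have : ((∑ k, (parity (w k)).val : ℕ) : ZMod 2) = 0 := by
          rw [Nat.cast_sum, ← hw]
          simp
        obtain ⟨m, hm⟩ := (ZMod.natCast_eq_zero_iff _ _).1 this
        rw [hm, pow_mul, Int.units_sq, one_pow]
      rw [Finset.prod_congr rfl fun k _ => h1 k, Finset.prod_mul_distrib, Finset.prod_mul_distrib,
        ← Int.cast_prod, ← Units.coe_prod, h2]
      simp
      ring
    · simp

/-! ### The gauge quotient as a quotient of a space of amplitudes -/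

/-- Labels of even parity. -/
abbrev EvenOcc (NF : ℕ) : Type := {i : Occ NF // parity i = 0}

/-- Labels of odd parity. -/
abbrev OddOcc (NF : ℕ) : Type := {i : Occ NF // parity i = 1}

/-- Pairs of vectors of amplitudes on the even and on the odd labels. -/
abbrev AmpSpace (NF : ℕ) : Type := EuclideanSpace ℂ (EvenOcc NF) × EuclideanSpace ℂ (OddOcc NF)

/-- Pairs of non-zero vectors of amplitudes. -/
abbrev Amp (NF : ℕ) : Type := {x : AmpSpace NF // x.1 ≠ 0 ∧ x.2 ≠ 0}

/-- The coefficients recorded by a pair of vectors of amplitudes. -/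
def AmpSpace.coeff {NF : ℕ} (x : AmpSpace NF) (i : Occ NF) : ℂ :=
  if h : parity i = 0 then x.1 ⟨i, h⟩ else x.2 ⟨i, (zmod_two_eq _).resolve_left h⟩

lemma AmpSpace.coeff_even {NF : ℕ} (x : AmpSpace NF) {i : Occ NF} (h : parity i = 0) :
    x.coeff i = x.1 ⟨i, h⟩ := dif_pos h

lemma AmpSpace.coeff_odd {NF : ℕ} (x : AmpSpace NF) {i : Occ NF} (h : parity i = 1) :
    x.coeff i = x.2 ⟨i, h⟩ :=
  dif_neg (by rw [h]; exact one_ne_zero)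

/-- The amplitudes of a vector of coefficients. -/
def toAmp {NF : ℕ} (b : Occ NF → ℂ) : AmpSpace NF :=
  (WithLp.toLp 2 fun i => b i.1, WithLp.toLp 2 fun i => b i.1)

lemma coeff_toAmp {NF : ℕ} (b : Occ NF → ℂ) : (toAmp b).coeff = b := by
  funext i
  rcases zmod_two_eq (parity i) with h | h
  · rw [AmpSpace.coeff_even _ h, toAmp]
  · rw [AmpSpace.coeff_odd _ h, toAmp]

lemma sum_eq_even_add_odd {NF : ℕ} (g : Occ NF → ℝ) :
    ∑ i, g i = ∑ i : EvenOcc NF, g i.1 + ∑ i : OddOcc NF, g i.1 := by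
  have h1 : ∑ i : EvenOcc NF, g i.1 = ∑ i with parity i = 0, g i :=
    (Finset.sum_subtype _ (by simp) g).symm
  have h2 : ∑ i : OddOcc NF, g i.1 = ∑ i with ¬ parity i = 0, g i := by
    refine (Finset.sum_subtype _ (fun i => ?_) g).symm
    rcases zmod_two_eq (parity i) with h | h <;> simp [h]
  rw [h1, h2, Finset.sum_filter_add_sum_filter_not]

lemma AmpSpace.sum_norm_coeff {NF : ℕ} (x : AmpSpace NF) :
    ∑ i, ‖x.coeff i‖ ^ 2 = ‖x.1‖ ^ 2 + ‖x.2‖ ^ 2 := by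
  rw [sum_eq_even_add_odd, EuclideanSpace.norm_sq_eq, EuclideanSpace.norm_sq_eq]
  congr 1
  · exact Finset.sum_congr rfl fun i _ => by rw [x.coeff_even i.2]
  · exact Finset.sum_congr rfl fun i _ => by rw [x.coeff_odd i.2]

/-- The euclidean length of a pair of vectors. -/
def AmpSpace.len {NF : ℕ} (x : AmpSpace NF) : ℝ := Real.sqrt (‖x.1‖ ^ 2 + ‖x.2‖ ^ 2)

lemma Amp.len_pos {NF : ℕ} (x : Amp NF) : 0 < AmpSpace.len x.1 := by
  have := norm_pos_iff.2 x.2.1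
  exact Real.sqrt_pos.2 (by positivity)

/-- Normalized coefficients. -/
def Amp.normCoeff {NF : ℕ} (x : Amp NF) (i : Occ NF) : ℂ :=
  ((AmpSpace.len x.1)⁻¹ : ℝ) * AmpSpace.coeff x.1 i

lemma Amp.isCoeff {NF : ℕ} (x : Amp NF) : IsCoeff x.normCoeff where
  even := by
    have h := x.2.1
    contrapose! h
    ext i
    have := h i.1 i.2
    rw [normCoeff, AmpSpace.coeff_even _ i.2] at this
    exact (mul_eq_zero.1 this).resolve_left (by exact_mod_cast inv_ne_zero x.len_pos.ne')
  odd := by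
    have h := x.2.2
    contrapose! h
    ext i
    have := h i.1 i.2
    rw [normCoeff, AmpSpace.coeff_odd _ i.2] at this
    exact (mul_eq_zero.1 this).resolve_left (by exact_mod_cast inv_ne_zero x.len_pos.ne')
  sum := by
    have hl := x.len_pos
    have : AmpSpace.len x.1 ^ 2 = ‖x.1.1‖ ^ 2 + ‖x.1.2‖ ^ 2 := Real.sq_sqrt (by positivity)
    simp only [normCoeff, norm_mul, mul_pow, ← Finset.mul_sum, AmpSpace.sum_norm_coeff, ← this,
      Complex.norm_real, Real.norm_eq_abs, sq_abs]
    field_simp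

/-- The gauge class of the family with given amplitudes, up to normalization. -/
def Amp.toNonTriv {NF : ℕ} (x : Amp NF) : NonTriv 1 NF := ⟦x.isCoeff.family⟧

/-- Normalization removes the modulus of a common factor, so for unnormalized amplitudes the gauge
phase becomes an arbitrary non-zero scalar. The classes are the orbits of `ℂˣ × {±1}`. -/
lemma Amp.toNonTriv_eq_iff {NF : ℕ} {x y : Amp NF} :
    x.toNonTriv = y.toNonTriv ↔
      ∃ c : ℂ, c ≠ 0 ∧ ∃ s : ℤˣ, x.1.1 = c • y.1.1 ∧ x.1.2 = (((s : ℤ) : ℂ) * c) • y.1.2 := by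
  have hx := x.len_pos
  have hy := y.len_pos
  have hx' : ((AmpSpace.len x.1 : ℝ) : ℂ) ≠ 0 := by exact_mod_cast hx.ne'
  have hy' : ((AmpSpace.len y.1 : ℝ) : ℂ) ≠ 0 := by exact_mod_cast hy.ne'
  rw [toNonTriv, toNonTriv, Quotient.eq]
  change GaugeEquiv (coeffMatrices _) (coeffMatrices _) ↔ _
  rw [gaugeEquiv_coeffMatrices_iff x.isCoeff]
  have hcast : ∀ z : Amp NF, ((AmpSpace.len z.1)⁻¹ : ℝ) = ((AmpSpace.len z.1 : ℝ) : ℂ)⁻¹ :=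
    fun z => by push_cast; rfl
  constructor
  · rintro ⟨c, hc, s, h0, h1⟩
    have hc0 : c ≠ 0 := by
      rintro rfl
      simp at hc
    refine ⟨AmpSpace.len x.1 / AmpSpace.len y.1 * c, by positivity, s, ?_, ?_⟩
    · ext i
      have := h0 i.1 i.2
      rw [normCoeff, normCoeff, AmpSpace.coeff_even _ i.2, AmpSpace.coeff_even _ i.2, hcast,
        hcast] at this
      field_simp at this
      simp only [PiLp.smul_apply, smul_eq_mul]
      field_simp
      exact this
    · ext i
      have := h1 i.1 i.2
      rw [normCoeff, normCoeff, AmpSpace.coeff_odd _ i.2, AmpSpace.coeff_odd _ i.2, hcast,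
        hcast] at this
      field_simp at this
      simp only [PiLp.smul_apply, smul_eq_mul]
      field_simp
      linear_combination this
  · rintro ⟨c, hc, s, h0, h1⟩
    have hs1 : ‖((s : ℤ) : ℂ)‖ = 1 := by
      rcases Int.units_eq_one_or s with rfl | rfl <;> simp
    have hlen : AmpSpace.len x.1 = ‖c‖ * AmpSpace.len y.1 := by
      rw [AmpSpace.len, AmpSpace.len, h0, h1, norm_smul, norm_smul, norm_mul, hs1, one_mul,
        mul_pow, mul_pow, ← mul_add, Real.sqrt_mul (by positivity), Real.sqrt_sq (norm_nonneg c)]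
    have hcn : ((‖c‖ : ℝ) : ℂ) ≠ 0 := by simpa using hc
    refine ⟨c / ‖c‖, by simp [hc], s, fun i hi => ?_, fun i hi => ?_⟩
    · rw [normCoeff, normCoeff, AmpSpace.coeff_even _ hi, AmpSpace.coeff_even _ hi, hcast, hcast,
        h0, hlen]
      simp only [PiLp.smul_apply, smul_eq_mul]
      push_cast
      field_simp
    · rw [normCoeff, normCoeff, AmpSpace.coeff_odd _ hi, AmpSpace.coeff_odd _ hi, hcast, hcast,
        h1, hlen]
      simp only [PiLp.smul_apply, smul_eq_mul]
      push_cast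
      field_simp

lemma IsCoeff.toAmp_ne {NF : ℕ} {b : Occ NF → ℂ} (hb : IsCoeff b) :
    (toAmp b).1 ≠ 0 ∧ (toAmp b).2 ≠ 0 := by
  constructor
  · intro h
    obtain ⟨i, hi, hbi⟩ := hb.even
    have := AmpSpace.coeff_even (toAmp b) hi
    rw [coeff_toAmp, h] at this
    exact hbi this
  · intro h
    obtain ⟨i, hi, hbi⟩ := hb.odd
    have := AmpSpace.coeff_odd (toAmp b) hi
    rw [coeff_toAmp, h] at this
    exact hbi this

/-- The class of a family, in terms of its coefficients. -/
lemma mk_eq_toNonTriv {NF : ℕ} (A : NonTrivTilde 1 NF) {W : BondMatrix 1}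
    (hW : W ∈ Matrix.unitaryGroup (Fin 2 × Fin 1) ℂ) {b : Occ NF → ℂ} (hb : IsCoeff b)
    (hA : A.1 = fun i => W * coeffMatrices b i * star W) :
    (⟦A⟧ : NonTriv 1 NF) = Amp.toNonTriv ⟨toAmp b, hb.toAmp_ne⟩ := by
  refine Quotient.sound fun L => ⟨1, by simp, ?_⟩
  have : Amp.normCoeff ⟨toAmp b, hb.toAmp_ne⟩ = b := by
    funext i
    have hl : AmpSpace.len (toAmp b) = 1 := by
      rw [AmpSpace.len, ← AmpSpace.sum_norm_coeff, coeff_toAmp, hb.sum, Real.sqrt_one]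
    simp only [Amp.normCoeff, hl, coeff_toAmp]
    simp
  rw [hA, state_unitary_conj hW, one_smul]
  change _ = state 1 (coeffMatrices _) L
  rw [this]

lemma Amp.toNonTriv_surjective {NF : ℕ} :
    Function.Surjective (Amp.toNonTriv : Amp NF → NonTriv 1 NF) := by
  intro q
  obtain ⟨A, rfl⟩ := Quotient.exists_rep q
  obtain ⟨W, hW, b, hb, hA⟩ := exists_isCoeff A
  exact ⟨_, (mk_eq_toNonTriv A hW hb hA).symm⟩

lemma continuous_coeff {NF : ℕ} (i : Occ NF) :
    Continuous fun x : AmpSpace NF => x.coeff i := by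
  rcases zmod_two_eq (parity i) with h | h
  · simp only [AmpSpace.coeff_even _ h]
    fun_prop
  · simp only [AmpSpace.coeff_odd _ h]
    fun_prop

lemma Amp.continuous_toNonTriv {NF : ℕ} :
    Continuous (Amp.toNonTriv : Amp NF → NonTriv 1 NF) := by
  refine continuous_quotient_mk'.comp (Continuous.subtype_mk ?_ _)
  refine continuous_pi fun i => continuous_pi fun a => continuous_pi fun c => ?_
  have hl : Continuous fun x : Amp NF => AmpSpace.len x.1 := by
    unfold AmpSpace.len
    fun_prop
  have hc : Continuous fun x : Amp NF => x.normCoeff i := by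
    unfold Amp.normCoeff
    exact (Complex.continuous_ofReal.comp (hl.inv₀ fun x => x.len_pos.ne')).mul
      ((continuous_coeff i).comp continuous_subtype_val)
  simp only [coeffMatrices, Matrix.kroneckerMap_apply, Matrix.smul_apply, smul_eq_mul]
  fun_prop

/-! ### Local recovery of amplitudes and the quotient topology -/

lemma isOpen_amp (NF : ℕ) : IsOpen {x : AmpSpace NF | x.1 ≠ 0 ∧ x.2 ≠ 0} :=
  (isOpen_ne.preimage continuous_fst).inter (isOpen_ne.preimage continuous_snd)

/-- Amplitudes extracted from a family, given a reference grading-odd matrix. -/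
def extract {NF : ℕ} (P : BondMatrix 1) (A : Occ NF → BondMatrix 1) : AmpSpace NF :=
  let u : EuclideanSpace ℂ (EvenOcc NF) := WithLp.toLp 2 fun i => (A i.1).trace / 2
  let t : EuclideanSpace ℂ (OddOcc NF) := WithLp.toLp 2 fun i => (A i.1 * P).trace / 2
  -- `t` is the odd vector times an unknown overlap of Wall matrices. The factor restores the length
  -- forced by `‖u‖² + ‖v‖² = 1`.
  (u, ((Real.sqrt (1 - ‖u‖ ^ 2) / ‖t‖ : ℝ) : ℂ) • t)

/-- The odd part from which `extract` starts. -/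
def oddPart {NF : ℕ} (P : BondMatrix 1) (A : Occ NF → BondMatrix 1) :
    EuclideanSpace ℂ (OddOcc NF) :=
  WithLp.toLp 2 fun i => (A i.1 * P).trace / 2

lemma continuous_oddPart {NF : ℕ} (P : BondMatrix 1) :
    Continuous (oddPart P : (Occ NF → BondMatrix 1) → _) := by
  unfold oddPart
  refine (PiLp.continuous_toLp 2 _).comp (continuous_pi fun i => ?_)
  exact ((((continuous_apply i.1).matrix_mul continuous_const)).matrix_trace).div_const 2

/-- The only obstruction is the division by the norm of the odd part. -/
lemma continuousOn_extract {NF : ℕ} (P : BondMatrix 1) :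
    ContinuousOn (extract P : (Occ NF → BondMatrix 1) → _) {A | oddPart P A ≠ 0} := by
  have h1 : Continuous fun A : Occ NF → BondMatrix 1 =>
      (WithLp.toLp 2 fun i => (A i.1).trace / 2 : EuclideanSpace ℂ (EvenOcc NF)) := by
    refine (PiLp.continuous_toLp 2 _).comp (continuous_pi fun i => ?_)
    exact ((continuous_apply i.1).matrix_trace).div_const 2
  have h2 := continuous_oddPart (NF := NF) P
  refine h1.continuousOn.prodMk (ContinuousOn.smul (Complex.continuous_ofReal.comp_continuousOn ?_)
    h2.continuousOn)
  exact ContinuousOn.div (Continuous.continuousOn (by fun_prop)) h2.norm.continuousOn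
    fun A hA => norm_ne_zero_iff.2 hA

/-- The Wall matrix `W σ_x W†`. -/
def wall (W : BondMatrix 1) : BondMatrix 1 :=
  W * (sigmaX ⊗ₖ (1 : Matrix (Fin 1) (Fin 1) ℂ)) * star W

lemma star_wall (W : BondMatrix 1) : star (wall W) = wall W := by
  have : star (sigmaX ⊗ₖ (1 : Matrix (Fin 1) (Fin 1) ℂ)) = sigmaX ⊗ₖ 1 := by
    rw [Matrix.star_eq_conjTranspose, Matrix.conjTranspose_kronecker,
      ← Matrix.star_eq_conjTranspose, sigmaX_star, Matrix.conjTranspose_one]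
  simp only [wall, star_mul, star_star, this, mul_assoc]

lemma wall_sq {W : BondMatrix 1} (hW : W ∈ Matrix.unitaryGroup (Fin 2 × Fin 1) ℂ) :
    wall W * wall W = 1 := by
  have h1 := Matrix.mem_unitaryGroup_iff.1 hW
  have h2 := Matrix.mem_unitaryGroup_iff'.1 hW
  have : wall W * wall W = W * ((sigmaX ⊗ₖ (1 : Matrix (Fin 1) (Fin 1) ℂ)) * (star W * W) *
      (sigmaX ⊗ₖ 1)) * star W := by
    simp only [wall, mul_assoc]
  rw [this, h2, mul_one, ← Matrix.mul_kronecker_mul, sigmaX_sq, one_mul, Matrix.one_kronecker_one,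
    mul_one, h1]

lemma trace_one_bond : (1 : BondMatrix 1).trace = 2 := by
  simp

/-- The overlap of two Wall matrices is real. -/
lemma exists_real_trace_wall (W W' : BondMatrix 1) :
    ∃ n : ℝ, (wall W * wall W').trace / 2 = (n : ℂ) := by
  refine ⟨((wall W * wall W').trace / 2).re, ?_⟩
  symm
  rw [← Complex.conj_eq_iff_re, map_div₀, map_ofNat]
  congr 1
  rw [starRingEnd_apply, ← Matrix.trace_conjTranspose, Matrix.conjTranspose_mul,
    ← Matrix.star_eq_conjTranspose, ← Matrix.star_eq_conjTranspose, star_wall, star_wall,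
    Matrix.trace_mul_comm]

lemma conj_coeffMatrices_even {NF : ℕ} {W : BondMatrix 1}
    (hW : W ∈ Matrix.unitaryGroup (Fin 2 × Fin 1) ℂ) (b : Occ NF → ℂ) {i : Occ NF}
    (hi : parity i = 0) : W * coeffMatrices b i * star W = b i • 1 := by
  have h1 := Matrix.mem_unitaryGroup_iff.1 hW
  rw [coeffMatrices_eq_smul, hi]
  simp [h1]

lemma conj_coeffMatrices_odd {NF : ℕ} (W : BondMatrix 1) (b : Occ NF → ℂ) {i : Occ NF}
    (hi : parity i = 1) : W * coeffMatrices b i * star W = b i • wall W := by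
  rw [coeffMatrices_eq_smul, hi, wall]
  simp [ZMod.val_one]

/-- Odd matrices are multiples of the Wall matrix of the family, so tracing against a reference Wall
matrix rescales all odd amplitudes by one common overlap. -/
lemma oddPart_conj {NF : ℕ} (W W' : BondMatrix 1) (b : Occ NF → ℂ) :
    oddPart (wall W') (fun i => W * coeffMatrices b i * star W) =
      ((wall W * wall W').trace / 2) • (toAmp b).2 := by
  ext i
  simp only [oddPart, PiLp.smul_apply, smul_eq_mul, toAmp, conj_coeffMatrices_odd W b i.2,
    Matrix.smul_mul, Matrix.trace_smul]
  ring

/-- The overlap of the Wall matrices is real because both are Hermitian. Renormalizing the length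
therefore leaves only its sign, which is the gauge ambiguity. -/
lemma extract_conj {NF : ℕ} {W : BondMatrix 1}
    (hW : W ∈ Matrix.unitaryGroup (Fin 2 × Fin 1) ℂ) (W' : BondMatrix 1) {b : Occ NF → ℂ}
    (hb : IsCoeff b) (h : oddPart (wall W') (fun i => W * coeffMatrices b i * star W) ≠ 0) :
    ∃ s : ℤˣ, extract (wall W') (fun i => W * coeffMatrices b i * star W) =
      ((toAmp b).1, ((s : ℤ) : ℂ) • (toAmp b).2) := by
  obtain ⟨n, hn⟩ := exists_real_trace_wall W W'
  rw [oddPart_conj, hn] at h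
  have hn0 : n ≠ 0 := by
    rintro rfl
    simp at h
  have hu : (WithLp.toLp 2 fun i : EvenOcc NF =>
      (W * coeffMatrices b i.1 * star W).trace / 2 : EuclideanSpace ℂ (EvenOcc NF)) =
      (toAmp b).1 := by
    ext i
    simp only [conj_coeffMatrices_even hW b i.2, Matrix.trace_smul, trace_one_bond, toAmp,
      smul_eq_mul]
    ring
  have hv0 : 0 < ‖(toAmp b).2‖ := norm_pos_iff.2 hb.toAmp_ne.2
  have hv : Real.sqrt (1 - ‖(toAmp b).1‖ ^ 2) = ‖(toAmp b).2‖ := by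
    have := (toAmp b).sum_norm_coeff
    rw [coeff_toAmp, hb.sum] at this
    rw [this, add_sub_cancel_left, Real.sqrt_sq (norm_nonneg _)]
  have he : extract (wall W') (fun i => W * coeffMatrices b i * star W) =
      ((toAmp b).1, ((‖(toAmp b).2‖ / ‖(n : ℂ) • (toAmp b).2‖ : ℝ) : ℂ) •
        (n : ℂ) • (toAmp b).2) := by
    have ho := oddPart_conj W W' b
    rw [hn] at ho
    simp only [oddPart] at ho
    simp only [extract, hu, ho, hv]
  rw [he, norm_smul, Complex.norm_real, Real.norm_eq_abs]
  rcases lt_or_gt_of_ne hn0 with h' | h'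
  · refine ⟨-1, Prod.ext rfl ?_⟩
    rw [smul_smul]
    congr 1
    rw [abs_of_neg h', ← Complex.ofReal_mul]
    have : ‖(toAmp b).2‖ / (-n * ‖(toAmp b).2‖) * n = -1 := by
      field_simp
    rw [this]
    simp
  · refine ⟨1, Prod.ext rfl ?_⟩
    rw [smul_smul]
    congr 1
    rw [abs_of_pos h', ← Complex.ofReal_mul]
    have : ‖(toAmp b).2‖ / (n * ‖(toAmp b).2‖) * n = 1 := by
      field_simp
    rw [this]
    simp

/-- A family with non-vanishing odd part has the class of its extracted amplitudes. -/
lemma mk_eq_extract {NF : ℕ} (A : NonTrivTilde 1 NF) (W' : BondMatrix 1)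
    (h : oddPart (wall W') A.1 ≠ 0) :
    ∃ hx : (extract (wall W') A.1).1 ≠ 0 ∧ (extract (wall W') A.1).2 ≠ 0,
      (⟦A⟧ : NonTriv 1 NF) = Amp.toNonTriv ⟨extract (wall W') A.1, hx⟩ := by
  obtain ⟨W, hW, b, hb, hA⟩ := exists_isCoeff A
  rw [mk_eq_toNonTriv A hW hb hA]
  rw [hA] at h
  obtain ⟨s, hs⟩ := extract_conj hW W' hb h
  have hss : ((s : ℤ) : ℂ) * ((s : ℤ) : ℂ) = 1 := by
    rcases Int.units_eq_one_or s with rfl | rfl <;> simp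
  have hs0 : ((s : ℤ) : ℂ) ≠ 0 := left_ne_zero_of_mul_eq_one hss
  have hx : (extract (wall W') A.1).1 ≠ 0 ∧ (extract (wall W') A.1).2 ≠ 0 := by
    rw [hA, hs]
    exact ⟨hb.toAmp_ne.1, smul_ne_zero hs0 hb.toAmp_ne.2⟩
  refine ⟨hx, Amp.toNonTriv_eq_iff.2 ⟨1, one_ne_zero, s, ?_, ?_⟩⟩
  · simp [hA, hs]
  · simp [hA, hs, smul_smul, hss]

/-- Rescaling of amplitudes by a non-zero number and a relative sign. -/
def Amp.act {NF : ℕ} (c : ℂˣ) (s : ℤˣ) (x : Amp NF) : Amp NF :=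
  ⟨((c : ℂ) • x.1.1, (((s : ℤ) : ℂ) * c) • x.1.2), smul_ne_zero c.ne_zero x.2.1,
    smul_ne_zero (mul_ne_zero (by simp) c.ne_zero) x.2.2⟩

lemma Amp.continuous_act {NF : ℕ} (c : ℂˣ) (s : ℤˣ) :
    Continuous (Amp.act c s : Amp NF → Amp NF) := by
  unfold Amp.act
  fun_prop

/-- The gauge quotient carries the quotient topology of the space of amplitudes, and the quotient
map is open. -/
theorem isOpenQuotientMap_toNonTriv (NF : ℕ) :
    IsOpenQuotientMap (Amp.toNonTriv : Amp NF → NonTriv 1 NF) := by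
  have hq : Topology.IsQuotientMap (Amp.toNonTriv : Amp NF → NonTriv 1 NF) := by
    refine ⟨.of_isOpen_preimage_iff_isOpen fun V => ⟨fun h => ?_,
      fun h => h.preimage Amp.continuous_toNonTriv⟩, Amp.toNonTriv_surjective⟩
    have hO : IsOpen ((↑) '' (Amp.toNonTriv ⁻¹' V : Set (Amp NF)) : Set (AmpSpace NF)) :=
      (isOpen_amp NF).isOpenMap_subtype_val _ h
    change IsOpen ((Quotient.mk (gaugeSetoid 1 NF)) ⁻¹' V)
    rw [isOpen_iff_mem_nhds]
    intro A₀ hA₀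
    obtain ⟨W₀, hW₀, b₀, hb₀, hA₀'⟩ := exists_isCoeff A₀
    have hΩ : IsOpen {A : Occ NF → BondMatrix 1 | oddPart (wall W₀) A ≠ 0} :=
      isOpen_ne.preimage (continuous_oddPart _)
    -- The reference is the Wall matrix of `A₀` itself: its overlap with itself is one, so the
    -- overlap stays non-zero near `A₀`.
    have hne : oddPart (wall W₀) A₀.1 ≠ 0 := by
      rw [hA₀', oddPart_conj, wall_sq hW₀, trace_one_bond]
      simpa using hb₀.toAmp_ne.2
    have hopen := ((continuousOn_extract (NF := NF) (wall W₀)).isOpen_inter_preimage hΩ hO).preimage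
      (continuous_subtype_val (p := fun A : Occ NF → BondMatrix 1 =>
        IsFMPS 1 A ∧ IsInjectiveMinus 1 A ∧ IsCanonical 1 A))
    refine Filter.mem_of_superset (hopen.mem_nhds ⟨hne, ?_⟩) ?_
    · obtain ⟨hx, e⟩ := mk_eq_extract A₀ W₀ hne
      refine ⟨⟨_, hx⟩, ?_, rfl⟩
      rw [Set.mem_preimage, ← e]
      exact hA₀
    · rintro A ⟨hA, ⟨x, hxV, hxe⟩⟩
      obtain ⟨hx, e⟩ := mk_eq_extract A W₀ hA
      rw [Set.mem_preimage, e]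
      convert Set.mem_preimage.1 hxV using 2
      exact Subtype.ext hxe.symm
  refine ⟨hq.surjective, hq.continuous, fun U hU => ?_⟩
  rw [← hq.isOpen_preimage]
  -- Openness holds because the saturation of an open set is a union of its translates under the
  -- rescaling action.
  have : Amp.toNonTriv ⁻¹' (Amp.toNonTriv '' U) =
      ⋃ (c : ℂˣ) (s : ℤˣ), (Amp.act c s : Amp NF → Amp NF) ⁻¹' U := by
    ext x
    simp only [Set.mem_preimage, Set.mem_image, Set.mem_iUnion]
    constructor
    · rintro ⟨y, hy, e⟩
      obtain ⟨c, hc, s, h0, h1⟩ := Amp.toNonTriv_eq_iff.1 e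
      refine ⟨Units.mk0 c hc, s, ?_⟩
      convert hy
      exact Subtype.ext (Prod.ext h0.symm h1.symm)
    · rintro ⟨c, s, h⟩
      exact ⟨_, h, Amp.toNonTriv_eq_iff.2 ⟨c, c.ne_zero, s, rfl, rfl⟩⟩
  rw [this]
  exact isOpen_iUnion fun c => isOpen_iUnion fun s => hU.preimage (Amp.continuous_act c s)

/-! ### The locus where an even matrix does not vanish -/

lemma coeffMatrices_ne_zero {NF : ℕ} {b : Occ NF → ℂ} {i : Occ NF} (h : b i ≠ 0) :
    coeffMatrices b i ≠ 0 := by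
  intro h0
  have := coeffMatrices_mul_star b i
  rw [h0, zero_mul] at this
  have := congrFun (congrFun this (0, 0)) (0, 0)
  exact h (by simpa using this.symm)

/-- Even matrices are scalar, `A^p = b_p · 1`, and a gauge change multiplies `b_p` by a non-zero
number. So `A^p ≠ 0` depends only on the class. -/
lemma toNonTriv_mem_locus_iff {NF : ℕ} {p : Occ NF} (hp : parity p = 0) (x : Amp NF) :
    x.toNonTriv ∈ locus 1 NF p ↔ x.1.1 ⟨p, hp⟩ ≠ 0 := by
  constructor
  · rintro ⟨A, hA, e⟩
    obtain ⟨W, hW, b, hb, hAb⟩ := exists_isCoeff A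
    rw [mk_eq_toNonTriv A hW hb hAb] at e
    obtain ⟨c, hc, s, h0, -⟩ := Amp.toNonTriv_eq_iff.1 e.symm
    rw [h0]
    refine mul_ne_zero hc ?_
    intro hbp
    rw [hAb] at hA
    refine hA ?_
    change W * coeffMatrices b p * star W = 0
    rw [conj_coeffMatrices_even hW b hp, show b p = 0 from hbp, zero_smul]
  · intro h
    refine ⟨x.isCoeff.family, coeffMatrices_ne_zero ?_, rfl⟩
    rw [Amp.normCoeff, AmpSpace.coeff_even _ hp]
    exact mul_ne_zero (by exact_mod_cast inv_ne_zero x.len_pos.ne') h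

/-- The number of odd labels. -/
lemma two_mul_card_oddOcc {NF : ℕ} (f : Fin NF) : 2 * Fintype.card (OddOcc NF) = 2 ^ NF := by
  have hadd : ∀ i : Occ NF, parity (i + Pi.single f 1) = parity i + 1 := fun i => by
    have : parity (i + Pi.single f 1) = parity i + parity (Pi.single f 1) := by
      simp only [parity, Pi.add_apply, Finset.sum_add_distrib]
    rw [this, parity_single]
  have hss : (Pi.single f 1 + Pi.single f 1 : Occ NF) = 0 := by
    funext g
    exact CharTwo.add_self_eq_zero _
  -- Flipping the occupation of flavor `f` exchanges the two parities, so each accounts for half of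
  -- the labels.
  let e : EvenOcc NF ≃ OddOcc NF :=
    { toFun := fun i => ⟨i.1 + Pi.single f 1, by rw [hadd, i.2, zero_add]⟩
      invFun := fun i => ⟨i.1 + Pi.single f 1, by rw [hadd, i.2]; rfl⟩
      left_inv := fun i => Subtype.ext (by
        change i.1 + Pi.single f 1 + Pi.single f 1 = i.1
        rw [add_assoc, hss, add_zero])
      right_inv := fun i => Subtype.ext (by
        change i.1 + Pi.single f 1 + Pi.single f 1 = i.1
        rw [add_assoc, hss, add_zero]) }
  have h1 : Fintype.card (Occ NF) = 2 ^ NF := by simp [ZMod.card]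
  have h2 := Fintype.card_subtype_compl fun i : Occ NF => parity i = 0
  have h3 : Fintype.card {i : Occ NF // ¬ parity i = 0} = Fintype.card (OddOcc NF) := by
    refine Fintype.card_congr (Equiv.subtypeEquivRight fun i => ?_)
    rcases zmod_two_eq (parity i) with h | h <;> simp [h]
  have h4 : Fintype.card {i : Occ NF // parity i = 0} = _ := Fintype.card_congr e
  have h5 := Fintype.card_subtype_le fun i : Occ NF => parity i = 0
  rw [h3, h1] at h2
  rw [h1] at h5
  omega

lemma finrank_real_euclideanSpace_complex (ι : Type*) [Fintype ι] :
    Module.finrank ℝ (EuclideanSpace ℂ ι) = 2 * Fintype.card ι := by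
  rw [← Module.finrank_mul_finrank ℝ ℂ (EuclideanSpace ℂ ι), Complex.finrank_real_complex,
    finrank_euclideanSpace]

/-- Complex euclidean space as a real euclidean space. -/
def realIso (ι : Type*) [Fintype ι] {n : ℕ} (h : 2 * Fintype.card ι = n) :
    EuclideanSpace ℂ ι ≃ₗᵢ[ℝ] EuclideanSpace ℝ (Fin n) :=
  ((stdOrthonormalBasis ℝ (EuclideanSpace ℂ ι)).reindex
    (finCongr ((finrank_real_euclideanSpace_complex ι).trans h))).repr

section Locus

variable {NF : ℕ} {p : Occ NF} (hp : parity p = 0)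

/-- Amplitudes over the locus `A^p ≠ 0`. -/
abbrev LocusAmp (p : Occ NF) : Type := (Amp.toNonTriv : Amp NF → NonTriv 1 NF) ⁻¹' locus 1 NF p

/-- The projection from amplitudes to the locus. -/
def locusProj (p : Occ NF) : C(LocusAmp p, locus 1 NF p) :=
  ⟨(locus 1 NF p).restrictPreimage Amp.toNonTriv,
    (isOpenQuotientMap_toNonTriv NF).continuous.restrictPreimage⟩

lemma isOpenQuotientMap_locusProj (p : Occ NF) : IsOpenQuotientMap (locusProj p) :=
  (isOpenQuotientMap_toNonTriv NF).restrictPreimage _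

lemma locusProj_eq_iff {x y : LocusAmp p} : locusProj p x = locusProj p y ↔
    ∃ c : ℂ, c ≠ 0 ∧ ∃ s : ℤˣ, x.1.1.1 = c • y.1.1.1 ∧
      x.1.1.2 = (((s : ℤ) : ℂ) * c) • y.1.1.2 := by
  rw [← Amp.toNonTriv_eq_iff]
  exact Subtype.ext_iff

/-- The amplitude of the label `p`. -/
def pivot (x : LocusAmp p) : ℂ := x.1.1.1 ⟨p, hp⟩

lemma pivot_ne_zero (x : LocusAmp p) : pivot hp x ≠ 0 :=
  (toNonTriv_mem_locus_iff hp x.1).1 x.2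

lemma continuous_pivot : Continuous (pivot hp) := by
  unfold pivot
  fun_prop

/-- The direction of the odd amplitudes relative to the phase of the pivot. -/
def oddDir (x : LocusAmp p) : EuclideanSpace ℂ (OddOcc NF) :=
  (star (pivot hp x) / (‖pivot hp x‖ * ‖x.1.1.2‖ : ℝ)) • x.1.1.2

lemma norm_oddDir (x : LocusAmp p) : ‖oddDir hp x‖ = 1 := by
  have h1 := norm_pos_iff.2 (pivot_ne_zero hp x)
  have h2 := norm_pos_iff.2 x.1.2.2
  rw [oddDir, norm_smul, norm_div, norm_star, Complex.norm_real, Real.norm_of_nonneg (by positivity)]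
  field_simp

lemma continuous_oddDir : Continuous (oddDir hp) := by
  have h := continuous_pivot hp
  unfold oddDir
  have hnum : Continuous fun x : LocusAmp p => star (pivot hp x) := by fun_prop
  have hden : Continuous fun x : LocusAmp p => ((‖pivot hp x‖ * ‖x.1.1.2‖ : ℝ) : ℂ) := by fun_prop
  have hv : Continuous fun x : LocusAmp p => x.1.1.2 := by fun_prop
  refine (hnum.div hden fun x => ?_).smul hv
  have h1 := norm_pos_iff.2 (pivot_ne_zero hp x)
  have h2 := norm_pos_iff.2 x.1.2.2
  exact_mod_cast (by positivity : ‖pivot hp x‖ * ‖x.1.1.2‖ ≠ 0)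

variable (f : Fin NF)

/-- The real isometry from odd amplitudes to the ambient space of the sphere. -/
def oddIso : EuclideanSpace ℂ (OddOcc NF) ≃ₗᵢ[ℝ] EuclideanSpace ℝ (Fin (2 ^ NF - 1 + 1)) :=
  realIso _ ((two_mul_card_oddOcc f).trans (Nat.sub_add_cancel Nat.one_le_two_pow).symm)

/-- The point of projective space of a vector of amplitudes. -/
def dirRP (x : LocusAmp p) : RP (2 ^ NF - 1) :=
  toRP _ ⟨oddIso f (oddDir hp x), by simp [norm_oddDir]⟩

lemma continuous_dirRP : Continuous (dirRP hp f) := by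
  refine continuous_quotient_mk'.comp (Continuous.subtype_mk ?_ _)
  exact (oddIso f).continuous.comp (continuous_oddDir hp)

/-- Under `(u, v) ↦ (cu, ±cv)` the conjugate pivot cancels the phase of `c`, and the norms cancel
its modulus. Only the sign is left, and projective space forgets it. -/
lemma dirRP_congr {x y : LocusAmp p} (h : locusProj p x = locusProj p y) :
    dirRP hp f x = dirRP hp f y := by
  obtain ⟨c, hc, s, h0, h1⟩ := locusProj_eq_iff.1 h
  have hpx : pivot hp x = c * pivot hp y := by
    rw [pivot, h0]
    rfl
  have hs1 : ‖((s : ℤ) : ℂ)‖ = 1 := by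
    rcases Int.units_eq_one_or s with rfl | rfl <;> simp
  have hdir : oddDir hp x = ((s : ℤ) : ℂ) • oddDir hp y := by
    have h2 := norm_pos_iff.2 (pivot_ne_zero hp y)
    have h3 := norm_pos_iff.2 y.1.2.2
    have h4 := norm_pos_iff.2 hc
    rw [oddDir, oddDir, h1, hpx, smul_smul, smul_smul, norm_smul, norm_mul, norm_mul, hs1, one_mul]
    congr 1
    have hcc : star c * c = (‖c‖ : ℂ) ^ 2 := by
      rw [Complex.star_def, Complex.conj_mul']
    have h4' : (‖c‖ : ℂ) ≠ 0 := by exact_mod_cast h4.ne'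
    have h2' : (‖pivot hp y‖ : ℂ) ≠ 0 := by exact_mod_cast h2.ne'
    have h3' : (‖y.1.1.2‖ : ℂ) ≠ 0 := by exact_mod_cast h3.ne'
    rw [star_mul]
    push_cast
    field_simp
    linear_combination star (pivot hp y) * hcc
  refine toRP_eq_iff.2 ?_
  rcases Int.units_eq_one_or s with rfl | rfl
  · left
    refine Subtype.ext ?_
    simp [hdir]
  · right
    refine Subtype.ext ?_
    rw [coe_neg_sphere]
    simp [hdir]

/-- The map from the locus to real projective space. -/
def locusToRP : C(locus 1 NF p, RP (2 ^ NF - 1)) :=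
  Topology.IsQuotientMap.lift (f := locusProj p) (isOpenQuotientMap_locusProj p).isQuotientMap
    ⟨dirRP hp f, continuous_dirRP hp f⟩ fun _ _ h => dirRP_congr hp f h

lemma locusToRP_proj (x : LocusAmp p) : locusToRP hp f (locusProj p x) = dirRP hp f x :=
  DFunLike.congr_fun (Topology.IsQuotientMap.lift_comp
    (isOpenQuotientMap_locusProj p).isQuotientMap (⟨dirRP hp f, continuous_dirRP hp f⟩ : C(_, _))
    fun _ _ h => dirRP_congr hp f h) x

/-- Amplitudes of the family with given odd direction and `p` as the only even label. -/
def sphereAmp (x : Metric.sphere (0 : EuclideanSpace ℝ (Fin (2 ^ NF - 1 + 1))) 1) : LocusAmp p :=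
  ⟨⟨(EuclideanSpace.single ⟨p, hp⟩ 1, (oddIso f).symm x.1), by
    constructor
    · intro h
      have := congrArg (fun z : EuclideanSpace ℂ (EvenOcc NF) => z ⟨p, hp⟩) h
      simp at this
    · rw [← norm_pos_iff]
      simp⟩, by
    rw [Set.mem_preimage, toNonTriv_mem_locus_iff hp]
    simp⟩

lemma continuous_sphereAmp : Continuous (sphereAmp hp f) := by
  refine Continuous.subtype_mk (Continuous.subtype_mk (continuous_const.prodMk ?_) _) _
  exact (oddIso f).symm.continuous.comp continuous_subtype_val

/-- The map from real projective space to the locus. -/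
def rpToLocus : C(RP (2 ^ NF - 1), locus 1 NF p) :=
  ⟨Quotient.lift (fun x => locusProj p (sphereAmp hp f x)) (by
    rintro x y (rfl | rfl)
    · rfl
    · refine locusProj_eq_iff.2 ⟨1, one_ne_zero, -1, ?_, ?_⟩
      · simp [sphereAmp]
      · simp [sphereAmp]),
    ((locusProj p).continuous.comp (continuous_sphereAmp hp f)).quotient_lift _⟩

lemma rpToLocus_toRP (x : Metric.sphere (0 : EuclideanSpace ℝ (Fin (2 ^ NF - 1 + 1))) 1) :
    rpToLocus hp f (toRP _ x) = locusProj p (sphereAmp hp f x) := rfl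

/-- On the model amplitudes the pivot is one and the odd vector is a unit vector, so this composite
is the identity on the nose. -/
lemma locusToRP_comp_rpToLocus :
    (locusToRP hp f).comp (rpToLocus hp f) = ContinuousMap.id _ := by
  ext q
  obtain ⟨x, rfl⟩ := (isQuotientCoveringMap_toRP _).surjective q
  rw [ContinuousMap.comp_apply, rpToLocus_toRP, locusToRP_proj, ContinuousMap.id_apply, dirRP]
  congr 1
  refine Subtype.ext ?_
  have : oddDir hp (sphereAmp hp f x) = (oddIso f).symm x.1 := by
    simp [oddDir, pivot, sphereAmp]
  simp [this]

/-- The straight line from a vector of amplitudes to one with `p` as the only even label. -/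
def contractAmp (y : unitInterval × LocusAmp p) : LocusAmp p :=
  ⟨⟨(((1 - (y.1 : ℝ) : ℝ) : ℂ) • y.2.1.1.1 +
      ((y.1 : ℝ) : ℂ) • EuclideanSpace.single ⟨p, hp⟩ (pivot hp y.2),
    -- The factor moves the odd norm to that of the pivot, so that at time one the pair is the pivot
    -- times a model pair. It depends only on the ratio of the norms, hence is gauge invariant.
    ((1 - (y.1 : ℝ) + y.1 * (‖pivot hp y.2‖ / ‖y.2.1.1.2‖) : ℝ) : ℂ) • y.2.1.1.2), by
    constructor
    · intro h
      have := congrArg (fun z : EuclideanSpace ℂ (EvenOcc NF) => z ⟨p, hp⟩) h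
      simp only [PiLp.add_apply, PiLp.smul_apply, PiLp.single_apply, if_true,
        smul_eq_mul, PiLp.zero_apply] at this
      refine pivot_ne_zero hp y.2 ?_
      rw [← this, pivot]
      push_cast
      ring
    · refine smul_ne_zero ?_ y.2.1.2.2
      have h2 := norm_pos_iff.2 (pivot_ne_zero hp y.2)
      have h3 := norm_pos_iff.2 y.2.1.2.2
      have h4 := div_pos h2 h3
      have : 0 < 1 - (y.1 : ℝ) + y.1 * (‖pivot hp y.2‖ / ‖y.2.1.1.2‖) := by
        rcases eq_or_lt_of_le y.1.2.1 with h | h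
        · rw [← h]
          norm_num
        · have := y.1.2.2
          have := mul_pos h h4
          linarith
      exact_mod_cast this.ne'⟩, by
    rw [Set.mem_preimage, toNonTriv_mem_locus_iff hp]
    simp only [PiLp.add_apply, PiLp.smul_apply, PiLp.single_apply, if_true, smul_eq_mul]
    convert pivot_ne_zero hp y.2 using 1
    rw [pivot]
    push_cast
    ring⟩

lemma continuous_contractAmp : Continuous (contractAmp hp) := by
  have h := continuous_pivot hp
  refine Continuous.subtype_mk (Continuous.subtype_mk (Continuous.prodMk ?_ ?_) _) _
  · have ht : Continuous fun y : unitInterval × LocusAmp p => ((y.1 : ℝ) : ℂ) := by fun_prop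
    refine Continuous.add (by fun_prop) (ht.smul ?_)
    exact (PiLp.continuous_toLp 2 _).comp ((continuous_single _).comp (h.comp continuous_snd))
  · have hv : Continuous fun y : unitInterval × LocusAmp p => y.2.1.1.2 := by fun_prop
    refine (Complex.continuous_ofReal.comp ?_).smul hv
    have ht : Continuous fun y : unitInterval × LocusAmp p => (y.1 : ℝ) := by fun_prop
    refine Continuous.add (by fun_prop) (ht.mul ?_)
    exact Continuous.div (by fun_prop) (by fun_prop) fun y => norm_ne_zero_iff.2 y.2.1.2.2

lemma contractAmp_congr (t : unitInterval) {x y : LocusAmp p} (h : locusProj p x = locusProj p y) :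
    locusProj p (contractAmp hp (t, x)) = locusProj p (contractAmp hp (t, y)) := by
  obtain ⟨c, hc, s, h0, h1⟩ := locusProj_eq_iff.1 h
  have hpx : pivot hp x = c * pivot hp y := by
    rw [pivot, h0]
    rfl
  have hs1 : ‖((s : ℤ) : ℂ)‖ = 1 := by
    rcases Int.units_eq_one_or s with rfl | rfl <;> simp
  refine locusProj_eq_iff.2 ⟨c, hc, s, ?_, ?_⟩
  · simp only [contractAmp, h0, hpx]
    ext i
    simp only [PiLp.add_apply, PiLp.smul_apply, PiLp.single_apply, smul_eq_mul]
    split_ifs <;> ring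
  · have h4 := norm_ne_zero_iff.2 hc
    simp only [contractAmp, h1, hpx, norm_smul, norm_mul, hs1, one_mul]
    rw [mul_div_mul_left _ _ h4, smul_smul, smul_smul, mul_comm]

lemma locusProj_contractAmp_one (x : LocusAmp p) :
    locusProj p (contractAmp hp (1, x)) =
      locusProj p (sphereAmp hp f ⟨oddIso f (oddDir hp x), by simp [norm_oddDir]⟩) := by
  refine locusProj_eq_iff.2 ⟨pivot hp x, pivot_ne_zero hp x, 1, ?_, ?_⟩
  · ext i
    simp [contractAmp, sphereAmp]
  · have h2 : (‖pivot hp x‖ : ℂ) ≠ 0 := by exact_mod_cast norm_ne_zero_iff.2 (pivot_ne_zero hp x)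
    have h3 : (‖x.1.1.2‖ : ℂ) ≠ 0 := by exact_mod_cast norm_ne_zero_iff.2 x.1.2.2
    have hcc : pivot hp x * star (pivot hp x) = (‖pivot hp x‖ : ℂ) ^ 2 := by
      rw [Complex.star_def, Complex.mul_conj']
    simp only [contractAmp, sphereAmp, LinearIsometryEquiv.symm_apply_apply, oddDir, smul_smul]
    congr 1
    simp
    field_simp
    simpa using hcc.symm

/-- The locus where the matrix of an even label does not vanish is homotopy equivalent to a real
projective space. -/
def locusHomotopyEquiv : locus 1 NF p ≃ₕ RP (2 ^ NF - 1) where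
  toFun := locusToRP hp f
  invFun := rpToLocus hp f
  left_inv := by
    -- Openness matters here: the product of the interval with an open quotient map is again a
    -- quotient map, so the homotopy descends jointly continuously.
    have hq : IsOpenQuotientMap (Prod.map id (locusProj p) :
        unitInterval × LocusAmp p → unitInterval × locus 1 NF p) :=
      IsOpenQuotientMap.id.prodMap (isOpenQuotientMap_locusProj p)
    let q : C(unitInterval × LocusAmp p, unitInterval × locus 1 NF p) := ⟨_, hq.continuous⟩
    have hq' : Topology.IsQuotientMap q := hq.isQuotientMap
    let g : C(unitInterval × LocusAmp p, locus 1 NF p) :=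
      (locusProj p).comp ⟨contractAmp hp, continuous_contractAmp hp⟩
    have hg : Function.FactorsThrough g q := by
      rintro ⟨t, x⟩ ⟨t', y⟩ h
      obtain ⟨rfl, h'⟩ := Prod.mk.inj h
      exact contractAmp_congr hp t h'
    let H := hq'.lift g hg
    have hH : ∀ t x, H (t, locusProj p x) = locusProj p (contractAmp hp (t, x)) := fun t x =>
      DFunLike.congr_fun (hq'.lift_comp g hg) (t, x)
    refine ContinuousMap.Homotopic.symm ⟨⟨H, fun q => ?_, fun q => ?_⟩⟩
    · obtain ⟨x, rfl⟩ := (isOpenQuotientMap_locusProj p).surjective q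
      change H (0, _) = _
      rw [hH, ContinuousMap.id_apply]
      refine congrArg (locusProj p) ?_
      refine Subtype.ext (Subtype.ext ?_)
      simp [contractAmp]
    · obtain ⟨x, rfl⟩ := (isOpenQuotientMap_locusProj p).surjective q
      change H (1, _) = rpToLocus hp f (locusToRP hp f (locusProj p x))
      rw [hH, locusToRP_proj, dirRP, rpToLocus_toRP, locusProj_contractAmp_one]
  right_inv := by
    rw [locusToRP_comp_rpToLocus]

end Locus

/-! ### Non-triviality of loops twisting the odd amplitudes -/

/-- The products `v_k \bar u_j` of odd amplitudes and conjugate even amplitudes. -/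
def tensor {NF : ℕ} (x : AmpSpace NF) : EuclideanSpace ℂ (OddOcc NF × EvenOcc NF) :=
  WithLp.toLp 2 fun k => x.2 k.1 * star (x.1 k.2)

lemma tensor_ne_zero {NF : ℕ} (x : Amp NF) : tensor x.1 ≠ 0 := by
  intro h
  obtain ⟨j, hj⟩ : ∃ j, x.1.1 j ≠ 0 := by
    by_contra hc
    push Not at hc
    exact x.2.1 (PiLp.ext hc)
  obtain ⟨k, hk⟩ : ∃ k, x.1.2 k ≠ 0 := by
    by_contra hc
    push Not at hc
    exact x.2.2 (PiLp.ext hc)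
  have := congrArg (fun z : EuclideanSpace ℂ (OddOcc NF × EvenOcc NF) => z (k, j)) h
  exact mul_ne_zero hk (star_ne_zero.2 hj) this

lemma continuous_tensor {NF : ℕ} : Continuous (tensor : AmpSpace NF → _) := by
  refine (PiLp.continuous_toLp 2 _).comp (continuous_pi fun k => ?_)
  have h1 : Continuous fun x : AmpSpace NF => x.2 k.1 := by fun_prop
  have h2 : Continuous fun x : AmpSpace NF => x.1 k.2 := by fun_prop
  exact h1.mul h2.star

/-- The dimension of the projective space classifying the double cover. -/
def tensorDim (NF : ℕ) : ℕ := 2 * Fintype.card (OddOcc NF × EvenOcc NF) - 1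

lemma tensorDim_succ {NF : ℕ} (f : Fin NF) :
    2 * Fintype.card (OddOcc NF × EvenOcc NF) = tensorDim NF + 1 := by
  have : 0 < Fintype.card (OddOcc NF × EvenOcc NF) :=
    Fintype.card_pos_iff.2 ⟨⟨⟨Pi.single f 1, parity_single f⟩, ⟨0, parity_zero⟩⟩⟩
  rw [tensorDim]
  omega

/-- The tensor of a vector of amplitudes as a point of the sphere. -/
def tensorSphere {NF : ℕ} (f : Fin NF) (x : Amp NF) :
    Metric.sphere (0 : EuclideanSpace ℝ (Fin (tensorDim NF + 1))) 1 :=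
  ⟨‖tensor x.1‖⁻¹ • realIso _ (tensorDim_succ f) (tensor x.1), by
    simp [norm_smul, tensor_ne_zero x]⟩

lemma continuous_tensorSphere {NF : ℕ} (f : Fin NF) :
    Continuous (tensorSphere f : Amp NF → _) := by
  have h : Continuous fun x : Amp NF => tensor x.1 :=
    continuous_tensor.comp continuous_subtype_val
  refine Continuous.subtype_mk (Continuous.smul (h.norm.inv₀ fun x => ?_) ?_) _
  · exact norm_ne_zero_iff.2 (tensor_ne_zero x)
  · exact (realIso _ (tensorDim_succ f)).continuous.comp h

lemma tensorSphere_of_real_smul {NF : ℕ} (f : Fin NF) {x y : Amp NF} {r : ℝ} (hr : r ≠ 0)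
    (h : tensor x.1 = r • tensor y.1) :
    (tensorSphere f x).1 = (r / |r|) • (tensorSphere f y).1 := by
  have h1 := norm_ne_zero_iff.2 (tensor_ne_zero y)
  have h2 := abs_ne_zero.2 hr
  simp only [tensorSphere, h, norm_smul, map_smul, smul_smul, Real.norm_eq_abs]
  congr 1
  field_simp

/-- In `v ⊗ ū` the scalar `c` meets its conjugate, so a gauge change multiplies the tensor by the
real number `±|c|²`. -/
lemma toRP_tensorSphere_congr {NF : ℕ} (f : Fin NF) {x y : Amp NF}
    (h : x.toNonTriv = y.toNonTriv) :
    toRP _ (tensorSphere f x) = toRP _ (tensorSphere f y) := by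
  obtain ⟨c, hc, s, h0, h1⟩ := Amp.toNonTriv_eq_iff.1 h
  have hcn := norm_pos_iff.2 hc
  have hcc : c * star c = (‖c‖ : ℂ) ^ 2 := by
    rw [Complex.star_def, Complex.mul_conj']
  have ht : tensor x.1 = (((s : ℤ) : ℝ) * ‖c‖ ^ 2) • tensor y.1 := by
    ext k
    simp only [tensor, h0, h1, PiLp.smul_apply, smul_eq_mul, star_mul, Complex.real_smul]
    push_cast
    linear_combination ((s : ℤ) : ℂ) * y.1.2 k.1 * star (y.1.1 k.2) * hcc
  refine toRP_eq_iff.2 ?_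
  rcases Int.units_eq_one_or s with rfl | rfl
  · left
    refine Subtype.ext ?_
    rw [tensorSphere_of_real_smul f (by simpa using hc) ht]
    simp [hcn.ne']
  · right
    refine Subtype.ext ?_
    rw [tensorSphere_of_real_smul f (by simpa using hc) ht, coe_neg_sphere]
    simp [hcn.ne']

/-- The map to real projective space classifying the double cover of the gauge quotient. -/
def tensorRP {NF : ℕ} (f : Fin NF) : C(NonTriv 1 NF, RP (tensorDim NF)) :=
  Topology.IsQuotientMap.lift
    (f := (⟨Amp.toNonTriv, Amp.continuous_toNonTriv⟩ : C(Amp NF, NonTriv 1 NF)))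
    (isOpenQuotientMap_toNonTriv NF).isQuotientMap
    ⟨fun x => toRP _ (tensorSphere f x),
      (isQuotientCoveringMap_toRP _).continuous.comp (continuous_tensorSphere f)⟩
    fun _ _ h => toRP_tensorSphere_congr f h

lemma tensorRP_toNonTriv {NF : ℕ} (f : Fin NF) (x : Amp NF) :
    tensorRP f x.toNonTriv = toRP _ (tensorSphere f x) :=
  DFunLike.congr_fun (Topology.IsQuotientMap.lift_comp
    (f := (⟨Amp.toNonTriv, Amp.continuous_toNonTriv⟩ : C(Amp NF, NonTriv 1 NF)))
    (isOpenQuotientMap_toNonTriv NF).isQuotientMap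
    ⟨fun x => toRP _ (tensorSphere f x),
      (isQuotientCoveringMap_toRP _).continuous.comp (continuous_tensorSphere f)⟩
    fun _ _ h => toRP_tensorSphere_congr f h) x

/-- Rotation of the odd amplitudes by the angle `πt`. -/
def twist {NF : ℕ} (x : Amp NF) (t : unitInterval) : Amp NF :=
  ⟨(x.1.1, Complex.exp (Real.pi * (t : ℝ) * Complex.I) • x.1.2), x.2.1,
    smul_ne_zero (Complex.exp_ne_zero _) x.2.2⟩

lemma continuous_twist {NF : ℕ} (x : Amp NF) : Continuous (twist x) := by
  unfold twist
  fun_prop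

lemma twist_zero {NF : ℕ} (x : Amp NF) : twist x 0 = x :=
  Subtype.ext (Prod.ext rfl (by simp [twist]))

/-- A half turn multiplies the odd amplitudes by `-1`, which is the relative sign of the gauge
relation. -/
lemma twist_one {NF : ℕ} (x : Amp NF) : (twist x 1).toNonTriv = x.toNonTriv :=
  Amp.toNonTriv_eq_iff.2 ⟨1, one_ne_zero, -1, by simp [twist], by simp [twist]⟩

/-- A loop that rotates the odd amplitudes by the angle `π` is not null-homotopic. -/
theorem not_homotopic_refl_of_twist {NF : ℕ} (f : Fin NF) (x : Amp NF) {q : NonTriv 1 NF}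
    (γ : Path q q) (h : ∀ t, γ t = (twist x t).toNonTriv) : ¬ γ.Homotopic (Path.refl q) := by
  refine not_homotopic_refl_of_lift (tensorRP f) γ
    ⟨fun t => tensorSphere f (twist x t), (continuous_tensorSphere f).comp (continuous_twist x)⟩
    (fun t => by rw [h, tensorRP_toNonTriv]; rfl) fun he => ?_
  change tensorSphere f (twist x 1) = tensorSphere f (twist x 0) at he
  have ht : tensor (twist x 1).1 = (-1 : ℝ) • tensor (twist x 0).1 := by
    ext k
    simp [tensor, twist]
  have h1 := tensorSphere_of_real_smul f (by norm_num) ht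
  rw [he] at h1
  have h2 : (tensorSphere f (twist x 0)).1 = 0 := by
    have h3 : (tensorSphere f (twist x 0)).1 = -(tensorSphere f (twist x 0)).1 := by
      simpa using h1
    have h4 : (2 : ℝ) • (tensorSphere f (twist x 0)).1 = 0 := by
      rw [two_smul]
      nth_rewrite 2 [h3]
      exact add_neg_cancel _
    exact (smul_eq_zero.1 h4).resolve_left two_ne_zero
  have := ne_zero_of_mem_unit_sphere (tensorSphere f (twist x 0))
  exact this h2

/-! ### The Kitaev loop as a half turn of the odd amplitudes -/

lemma isCoeff_kitaev {NF : ℕ} (f : Fin NF) (θ : ℝ) : IsCoeff (kitaevCoeff f θ) where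
  even := ⟨0, parity_zero, by
    rw [kitaevCoeff_zero]
    exact div_ne_zero one_ne_zero sqrt_two_ne⟩
  odd := ⟨Pi.single f 1, parity_single f, by
    rw [kitaevCoeff_single]
    exact div_ne_zero (Complex.exp_ne_zero _) sqrt_two_ne⟩
  sum := by
    have h : ∑ i, coeffMatrices (kitaevCoeff f θ) i * star (coeffMatrices (kitaevCoeff f θ) i) = 1 :=
      kitaev_isCanonical f θ
    rw [Finset.sum_congr rfl fun i _ => coeffMatrices_mul_star _ i, ← Finset.sum_smul,
      ← Complex.ofReal_sum] at h
    have := congrFun (congrFun h (0, 0)) (0, 0)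
    simp only [Matrix.smul_apply, Matrix.one_apply_eq, smul_eq_mul, mul_one] at this
    exact_mod_cast this

/-- The amplitude carries `e^{iθ/2}`, so a full turn `θ = 2πt` of the gap phase turns the odd vector
by `πt` only. -/
lemma kitaevPoint_eq_twist {NF : ℕ} (f : Fin NF) (t : unitInterval) :
    (kitaevPoint f (2 * Real.pi * (t : ℝ)) : NonTriv 1 NF) =
      (twist ⟨toAmp (kitaevCoeff f 0), (isCoeff_kitaev f 0).toAmp_ne⟩ t).toNonTriv := by
  refine (mk_eq_toNonTriv (kitaevMPS f _) (one_mem _)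
    (isCoeff_kitaev f (2 * Real.pi * (t : ℝ))) ?_).trans ?_
  · funext i
    rw [one_mul, star_one, mul_one]
    rfl
  · congr 1
    refine Subtype.ext (Prod.ext ?_ ?_)
    · ext i
      have : i.1 ≠ Pi.single f 1 := by
        intro h
        have := i.2
        rw [h, parity_single] at this
        exact one_ne_zero this
      simp [toAmp, twist, kitaevCoeff, this]
    · ext i
      have h0 : i.1 ≠ 0 := by
        intro h
        have := i.2
        rw [h, parity_zero] at this
        exact zero_ne_one this
      simp only [toAmp, twist, kitaevCoeff, h0, if_false, PiLp.smul_apply, smul_eq_mul]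
      split_ifs
      · rw [← mul_div_assoc, ← Complex.exp_add]
        congr 2
        push_cast
        ring
      · simp

/-- The loop of Kitaev chains is not null-homotopic in the gauge quotient. -/
theorem kitaevLoopFull_ne_one {NF : ℕ} (f : Fin NF) :
    FundamentalGroup.fromPath (Path.Homotopic.Quotient.mk (kitaevLoopFull f)) ≠ 1 := fun h =>
  not_homotopic_refl_of_twist f _ (kitaevLoopFull f) (fun t => kitaevPoint_eq_twist f t)
    (Path.Homotopic.Quotient.exact h)

/-- The loop of Kitaev chains is not null-homotopic in the vacuum locus. -/
theorem kitaevLoop_ne_one {NF : ℕ} (f : Fin NF) :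
    FundamentalGroup.fromPath (Path.Homotopic.Quotient.mk (kitaevLoop f)) ≠ 1 := fun h =>
  kitaevLoopFull_ne_one f (congrArg
    (FundamentalGroup.map (⟨Subtype.val, continuous_subtype_val⟩ : C(locus 1 NF 0, NonTriv 1 NF))
      (kitaevPoint f 0)) h)

/-! ### Fundamental groups -/

/-- The fundamental groups of the loci have order two. -/
theorem card_fundamentalGroup_locus {NF : ℕ} (hNF : 2 ≤ NF) {p : Occ NF} (hp : parity p = 0)
    (x : locus 1 NF p) : Nat.card (FundamentalGroup (locus 1 NF p) x) = 2 := by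
  have f : Fin NF := ⟨0, by omega⟩
  rw [Nat.card_congr (fundamentalGroupEquivOfHomotopyEquiv (locusHomotopyEquiv hp f) x).toEquiv]
  -- Two flavors make the dimension `2^NF - 1` at least three; for a single flavor the projective
  -- space would be a circle.
  refine card_fundamentalGroup_RP ?_ _
  have := Nat.pow_le_pow_right (n := 2) (by norm_num) hNF
  omega

lemma isOpen_locus {NF : ℕ} {p : Occ NF} (hp : parity p = 0) : IsOpen (locus 1 NF p) := by
  rw [← (isOpenQuotientMap_toNonTriv NF).isQuotientMap.isOpen_preimage]
  have : (Amp.toNonTriv : Amp NF → NonTriv 1 NF) ⁻¹' locus 1 NF p =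
      {x | x.1.1 ⟨p, hp⟩ ≠ 0} := by
    ext x
    exact toNonTriv_mem_locus_iff hp x
  rw [this]
  exact isOpen_ne_fun (by fun_prop) continuous_const

/-- The vector with all amplitudes equal to one. -/
def onesAmp {NF : ℕ} (f : Fin NF) : Amp NF :=
  ⟨(WithLp.toLp 2 fun _ => 1, WithLp.toLp 2 fun _ => 1),
    fun h => one_ne_zero (congrArg (fun z : EuclideanSpace ℂ (EvenOcc NF) =>
      z ⟨0, parity_zero⟩) h),
    fun h => one_ne_zero (congrArg (fun z : EuclideanSpace ℂ (OddOcc NF) =>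
      z ⟨Pi.single f 1, parity_single f⟩) h)⟩

lemma onesAmp_mem_locus {NF : ℕ} (f : Fin NF) {p : Occ NF} (hp : parity p = 0)
    (t : unitInterval) : (twist (onesAmp f) t).toNonTriv ∈ locus 1 NF p :=
  (toNonTriv_mem_locus_iff hp _).2 one_ne_zero

lemma countable_affine_zeros {a : ℂ} (ha : a ≠ 0) : {z : ℂ | a + z * (1 - a) = 0}.Countable := by
  refine Set.Subsingleton.countable fun z hz w hw => ?_
  rw [Set.mem_ofPred_eq] at hz hw
  have h1 : 1 - a ≠ 0 := by
    intro h
    rw [h, mul_zero, add_zero] at hz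
    exact ha hz
  exact mul_right_cancel₀ h1 (by linear_combination hz - hw)

/-- On the complex line through `x` and the all-ones vector, each of the three amplitudes that must
not vanish is an affine function of the parameter, non-zero at `0`. Its zeros are countable, and the
complement of a countable set in `ℂ` is path connected. -/
lemma joinedIn_onesAmp {NF : ℕ} (f : Fin NF) {p q : Occ NF} (hp : parity p = 0)
    (hq : parity q = 0) {y : NonTriv 1 NF} (hy : y ∈ locus 1 NF p ∩ locus 1 NF q) :
    JoinedIn (locus 1 NF p ∩ locus 1 NF q) (onesAmp f).toNonTriv y := by
  obtain ⟨x, rfl⟩ := Amp.toNonTriv_surjective y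
  have hxp := (toNonTriv_mem_locus_iff hp x).1 hy.1
  have hxq := (toNonTriv_mem_locus_iff hq x).1 hy.2
  obtain ⟨k, hk⟩ : ∃ k, x.1.2 k ≠ 0 := by
    by_contra hc
    push Not at hc
    exact x.2.2 (PiLp.ext hc)
  let G : Set ℂ := ({z | x.1.1 ⟨p, hp⟩ + z * (1 - x.1.1 ⟨p, hp⟩) = 0} ∪
    {z | x.1.1 ⟨q, hq⟩ + z * (1 - x.1.1 ⟨q, hq⟩) = 0} ∪
    {z | x.1.2 k + z * (1 - x.1.2 k) = 0})ᶜ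
  have hG : IsPathConnected G := by
    refine Set.Countable.isPathConnected_compl_of_one_lt_rank ?_
      (((countable_affine_zeros hxp).union (countable_affine_zeros hxq)).union
        (countable_affine_zeros hk))
    rw [Complex.rank_real_complex]
    norm_num
  have hmem : ∀ z, z ∈ G ↔ x.1.1 ⟨p, hp⟩ + z * (1 - x.1.1 ⟨p, hp⟩) ≠ 0 ∧
      x.1.1 ⟨q, hq⟩ + z * (1 - x.1.1 ⟨q, hq⟩) ≠ 0 ∧ x.1.2 k + z * (1 - x.1.2 k) ≠ 0 := by
    intro z
    simp only [G, Set.mem_compl_iff, Set.mem_union, Set.mem_ofPred_eq, not_or, and_assoc, ne_eq]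
  let F : G → Amp NF := fun z =>
    ⟨x.1 + (z : ℂ) • ((onesAmp f).1 - x.1), by
      constructor
      · intro h
        exact ((hmem z).1 z.2).1 (congrArg (fun z : EuclideanSpace ℂ (EvenOcc NF) =>
          z ⟨p, hp⟩) h)
      · intro h
        exact ((hmem z).1 z.2).2.2 (congrArg (fun z : EuclideanSpace ℂ (OddOcc NF) =>
          z k) h)⟩
  have hF : Continuous F := by
    refine Continuous.subtype_mk ?_ _
    fun_prop
  have h0 : (0 : ℂ) ∈ G := (hmem 0).2 (by simpa using ⟨hxp, hxq, hk⟩)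
  have h1 : (1 : ℂ) ∈ G := (hmem 1).2 (by simp)
  obtain ⟨γ⟩ : Joined (⟨1, h1⟩ : G) ⟨0, h0⟩ :=
    (isPathConnected_iff_pathConnectedSpace.1 hG).joined _ _
  have e0 : F ⟨0, h0⟩ = x := Subtype.ext (by simp [F])
  have e1 : F ⟨1, h1⟩ = onesAmp f := Subtype.ext (by simp [F])
  refine ⟨(γ.map (Amp.continuous_toNonTriv.comp hF)).cast ?_ ?_, fun t => ⟨?_, ?_⟩⟩
  · rw [Function.comp_apply, e1]
  · rw [Function.comp_apply, e0]
  · exact (toNonTriv_mem_locus_iff hp _).2 ((hmem (γ t)).1 (γ t).2).1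
  · exact (toNonTriv_mem_locus_iff hq _).2 ((hmem (γ t)).1 (γ t).2).2.1

lemma exists_mem_locus {NF : ℕ} (y : NonTriv 1 NF) : ∃ p : EvenOcc NF, y ∈ locus 1 NF p.1 := by
  obtain ⟨x, rfl⟩ := Amp.toNonTriv_surjective y
  by_contra hc
  push Not at hc
  refine x.2.1 (PiLp.ext fun p => ?_)
  have := hc p
  rw [toNonTriv_mem_locus_iff p.2, not_not] at this
  exact this

lemma onesAmp_mem {NF : ℕ} (f : Fin NF) (p : EvenOcc NF) :
    (onesAmp f).toNonTriv ∈ locus 1 NF p.1 :=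
  (toNonTriv_mem_locus_iff p.2 _).2 one_ne_zero

/-- The gauge quotient is path connected. -/
theorem pathConnectedSpace_nonTriv {NF : ℕ} (f : Fin NF) : PathConnectedSpace (NonTriv 1 NF) := by
  have hj : ∀ y, Joined (onesAmp f).toNonTriv y := fun y => by
    obtain ⟨p, hp⟩ := exists_mem_locus y
    exact (joinedIn_onesAmp f p.2 p.2 ⟨hp, hp⟩).joined
  exact ⟨⟨(onesAmp f).toNonTriv⟩, fun x y => (hj x).symm.trans (hj y)⟩

/-- The loop that rotates the odd amplitudes of `onesAmp`, inside a locus. -/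
def onesLoop {NF : ℕ} (f : Fin NF) (p : EvenOcc NF) :
    Path (⟨(onesAmp f).toNonTriv, onesAmp_mem f p⟩ : locus 1 NF p.1)
      ⟨(onesAmp f).toNonTriv, onesAmp_mem f p⟩ where
  toFun t := ⟨(twist (onesAmp f) t).toNonTriv, onesAmp_mem_locus f p.2 t⟩
  continuous_toFun := Continuous.subtype_mk
    (Amp.continuous_toNonTriv.comp (continuous_twist _)) _
  source' := Subtype.ext (congrArg Amp.toNonTriv (twist_zero _))
  target' := Subtype.ext (twist_one _)

/-- The fundamental group of the gauge quotient has order two. -/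
theorem card_fundamentalGroup_nonTriv {NF : ℕ} (hNF : 2 ≤ NF) (x : NonTriv 1 NF) :
    Nat.card (FundamentalGroup (NonTriv 1 NF) x) = 2 := by
  have f : Fin NF := ⟨0, by omega⟩
  have := pathConnectedSpace_nonTriv f
  rw [Nat.card_congr (FundamentalGroup.fundamentalGroupMulEquivOfPathConnected x
    (onesAmp f).toNonTriv).toEquiv]
  let ι : ∀ p : EvenOcc NF, C(locus 1 NF p.1, NonTriv 1 NF) := fun p =>
    ⟨Subtype.val, continuous_subtype_val⟩
  let o : ∀ p : EvenOcc NF, locus 1 NF p.1 := fun p => ⟨_, onesAmp_mem f p⟩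
  let p₀ : EvenOcc NF := ⟨0, parity_zero⟩
  let g : ∀ p : EvenOcc NF, FundamentalGroup (locus 1 NF p.1) (o p) := fun p =>
    Path.Homotopic.Quotient.mk (onesLoop f p)
  let τ : FundamentalGroup (NonTriv 1 NF) (onesAmp f).toNonTriv :=
    FundamentalGroup.map (ι p₀) (o p₀) (g p₀)
  -- The same loop in `M` represents the generator of every locus, so the loci contribute no
  -- independent classes.
  have hτ : ∀ p, FundamentalGroup.map (ι p) (o p) (g p) = τ :=
    fun p => rfl
  have hτ1 : τ ≠ 1 := fun h =>
    not_homotopic_refl_of_twist f (onesAmp f) ((onesLoop f p₀).map continuous_subtype_val)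
      (fun t => rfl) (Path.Homotopic.Quotient.exact h)
  have hloop : ∀ p, g p ≠ 1 := by
    intro p h
    apply hτ1
    rw [← hτ p, h, map_one]
  have hτ2 : τ ^ 2 = 1 := by
    have := pow_card_eq_one' (x := g p₀)
    rw [card_fundamentalGroup_locus hNF p₀.2] at this
    rw [← hτ p₀, ← map_pow, this, map_one]
  have htop : Subgroup.zpowers τ = ⊤ := by
    refine subgroup_eq_top_of_open_cover (U := fun p : EvenOcc NF => locus 1 NF p.1)
      (fun p => isOpen_locus p.2) exists_mem_locus (onesAmp_mem f) (fun p q =>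
        ⟨_, ⟨onesAmp_mem f p, onesAmp_mem f q⟩, fun {_} hy =>
          joinedIn_onesAmp f p.2 q.2 hy⟩)
      _ fun p γ hγ => ?_
    let δ : Path (o p) (o p) :=
      { toFun := fun t => ⟨γ t, hγ t⟩
        continuous_toFun := by fun_prop
        source' := Subtype.ext γ.source
        target' := Subtype.ext γ.target }
    let d : FundamentalGroup (locus 1 NF p.1) (o p) := Path.Homotopic.Quotient.mk δ
    have hδ : d ∈ Subgroup.zpowers (g p) := by
      rw [zpowers_eq_top_of_card_two (card_fundamentalGroup_locus hNF p.2 (o p)) (hloop p)]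
      trivial
    obtain ⟨n, hn⟩ := Subgroup.mem_zpowers_iff.1 hδ
    refine Subgroup.mem_zpowers_iff.2 ⟨n, ?_⟩
    rw [← hτ p, ← map_zpow, hn]
    rfl
  have : Fact (Nat.Prime 2) := ⟨Nat.prime_two⟩
  rw [← Subgroup.card_top, ← htop, Nat.card_zpowers, orderOf_eq_prime hτ2 hτ1]

/-! ### The ground state of the Kitaev chain -/

/-! ### Fermion operators in the occupation basis and the energy bound -/

section Fock

variable {L NF : ℕ}

/-- The configuration with a single fermion. -/
def unit (k : Fin L) (g : Fin NF) : Fin L → Occ NF := Pi.single k (Pi.single g 1)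

lemma add_unit_apply (s : Fin L → Occ NF) (k j : Fin L) (g h : Fin NF) :
    (s + unit k g) j h = s j h + if j = k ∧ h = g then 1 else 0 := by
  rw [Pi.add_apply, Pi.add_apply, unit, Pi.single_apply]
  split_ifs with h1 h2 h2
  · rw [h2.2, Pi.single_eq_same]
  · rw [Pi.single_eq_of_ne fun h3 => h2 ⟨h1, h3⟩]
  · exact absurd h2.1 h1
  · rfl

/-- Occupations live in `ℤ/2`, so adding `unit k g` flips a mode. Creation and annihilation thus
move indices by the same involution. -/
lemma add_unit_add_unit (s : Fin L → Occ NF) (k : Fin L) (g : Fin NF) :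
    s + unit k g + unit k g = s := by
  funext j h
  rw [add_unit_apply, add_unit_apply, add_assoc, CharTwo.add_self_eq_zero, add_zero]

/-- The sign of the annihilation operator. -/
def jwSign (k : Fin L) (g : Fin NF) (t : Fin L → Occ NF) : ℂ :=
  (-1 : ℂ) ^ (Finset.univ.filter fun m : Fin L × Fin NF =>
    (m.1 < k ∨ (m.1 = k ∧ m.2 < g)) ∧ t m.1 m.2 = 1).card

/-- Only modes strictly before `(k, g)` are counted. -/
lemma jwSign_add_unit (k : Fin L) (g : Fin NF) (t : Fin L → Occ NF) :
    jwSign k g (t + unit k g) = jwSign k g t := by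
  unfold jwSign
  congr 2
  ext m
  simp only [Finset.mem_filter, Finset.mem_univ, true_and, and_congr_right_iff]
  intro h
  rw [add_unit_apply, if_neg, add_zero]
  rintro ⟨h1, h2⟩
  rcases h with h | h
  · exact h.ne h1
  · exact h.2.ne h2

lemma norm_jwSign (k : Fin L) (g : Fin NF) (t : Fin L → Occ NF) : ‖jwSign k g t‖ = 1 := by
  simp [jwSign]

lemma star_jwSign (k : Fin L) (g : Fin NF) (t : Fin L → Occ NF) :
    star (jwSign k g t) = jwSign k g t := by
  simp [jwSign]

/-- Solving for the column index in terms of the row index collapses the sum in a matrix–vector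
product to one term. -/
lemma annihilation_cond_iff (k : Fin L) (g : Fin NF) (s t : Fin L → Occ NF) :
    (t k g = 1 ∧ s = Function.update t k (Function.update (t k) g 0)) ↔
      s k g = 0 ∧ t = s + unit k g := by
  have key : ∀ t : Fin L → Occ NF, t k g = 1 →
      Function.update t k (Function.update (t k) g 0) = t + unit k g := by
    intro t ht
    funext j h
    rw [add_unit_apply]
    by_cases hj : j = k
    · subst hj
      rw [Function.update_self]
      by_cases hh : h = g
      · subst hh
        rw [Function.update_self, ht, if_pos ⟨rfl, rfl⟩]
        rfl
      · rw [Function.update_of_ne hh, if_neg fun h' => hh h'.2, add_zero]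
    · rw [Function.update_of_ne hj, if_neg fun h' => hj h'.1, add_zero]
  constructor
  · rintro ⟨ht, rfl⟩
    rw [key t ht]
    refine ⟨?_, (add_unit_add_unit t k g).symm⟩
    rw [add_unit_apply, ht, if_pos ⟨rfl, rfl⟩]
    rfl
  · rintro ⟨hs, rfl⟩
    have h1 : (s + unit k g) k g = 1 := by
      rw [add_unit_apply, hs, if_pos ⟨rfl, rfl⟩, zero_add]
    exact ⟨h1, by rw [key _ h1, add_unit_add_unit]⟩

lemma annihilation_apply (k : Fin L) (g : Fin NF) (s t : Fin L → Occ NF) :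
    annihilation k g s t = if s k g = 0 ∧ t = s + unit k g then jwSign k g s else 0 := by
  rw [annihilation, Matrix.of_apply]
  simp only [annihilation_cond_iff]
  split_ifs with h
  · rw [h.2]
    exact jwSign_add_unit k g s
  · rfl

lemma annihilation_mulVec (k : Fin L) (g : Fin NF) (φ : (Fin L → Occ NF) → ℂ)
    (s : Fin L → Occ NF) : (annihilation k g).mulVec φ s =
      if s k g = 0 then jwSign k g s * φ (s + unit k g) else 0 := by
  simp only [Matrix.mulVec, dotProduct, annihilation_apply]
  split_ifs with h
  · simp [h]
  · simp [h]

lemma annihilation_conjTranspose_mulVec (k : Fin L) (g : Fin NF) (φ : (Fin L → Occ NF) → ℂ)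
    (s : Fin L → Occ NF) : (annihilation k g).conjTranspose.mulVec φ s =
      if s k g = 1 then jwSign k g s * φ (s + unit k g) else 0 := by
  have hc : ∀ t : Fin L → Occ NF,
      (t k g = 0 ∧ s = t + unit k g) ↔ (s k g = 1 ∧ t = s + unit k g) := by
    intro t
    constructor
    · rintro ⟨ht, rfl⟩
      rw [add_unit_add_unit, add_unit_apply, ht]
      simp
    · rintro ⟨hs, rfl⟩
      rw [add_unit_add_unit, add_unit_apply, hs, if_pos ⟨rfl, rfl⟩]
      exact ⟨rfl, rfl⟩
  have ha : ∀ t, star (annihilation k g t s) =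
      if s k g = 1 ∧ t = s + unit k g then jwSign k g s else 0 := by
    intro t
    rw [annihilation_apply]
    simp only [hc]
    split_ifs with h
    · rw [h.2, star_jwSign, jwSign_add_unit]
    · exact star_zero _
  simp only [Matrix.mulVec, dotProduct, Matrix.conjTranspose_apply, ha]
  split_ifs with h
  · simp [h]
  · simp [h]

/-- The boundary sign. -/
def boundarySign (k : Fin L) : ℂ := if (k : ℕ) + 1 = L then -1 else 1

lemma norm_boundarySign (k : Fin L) : ‖boundarySign k‖ = 1 := by
  unfold boundarySign
  split_ifs <;> simp

lemma star_boundarySign (k : Fin L) : star (boundarySign k) = boundarySign k := by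
  unfold boundarySign
  split_ifs <;> simp

lemma annihilationNext_eq (k : Fin L) (g : Fin NF) :
    annihilationNext k g = boundarySign k • annihilation (finRotate L k) g := rfl

/-- Hopping and pairing between a site and the next one. -/
def bondTerm (f : Fin NF) (θ : ℝ) (k : Fin L) :
    Matrix (Fin L → Occ NF) (Fin L → Occ NF) ℂ :=
  (annihilationNext k f).conjTranspose * annihilation k f +
    Complex.exp (Complex.I * θ) • (annihilationNext k f * annihilation k f)

/-- The coefficients of a bond term together with its adjoint. -/
def bondCoeff (f : Fin NF) (θ : ℝ) (k : Fin L) (s : Fin L → Occ NF) : ℂ :=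
  boundarySign k *
    if s k f = 0 then
      jwSign (finRotate L k) f s * jwSign k f (s + unit (finRotate L k) f) *
        if s (finRotate L k) f = 1 then 1 else Complex.exp (Complex.I * θ)
    else
      jwSign k f s * jwSign (finRotate L k) f (s + unit k f) *
        if s (finRotate L k) f = 0 then 1 else Complex.exp (-(Complex.I * θ))

lemma norm_bondCoeff (f : Fin NF) (θ : ℝ) (k : Fin L) (s : Fin L → Occ NF) :
    ‖bondCoeff f θ k s‖ = 1 := by
  have h1 : ‖Complex.exp (Complex.I * θ)‖ = 1 := by
    rw [mul_comm, Complex.norm_exp_ofReal_mul_I]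
  have h2 : ‖Complex.exp (-(Complex.I * θ))‖ = 1 := by
    rw [Complex.exp_neg, norm_inv, h1, inv_one]
  rw [bondCoeff, norm_mul, norm_boundarySign, one_mul]
  split_ifs <;> simp only [norm_mul, norm_jwSign, h1, h2, mul_one]

/-- Hopping, pairing and their adjoints all flip the same two distinct modes, and the occupations of
these modes select exactly one of the four. The Hermitian bond term is therefore a permutation with
unimodular weights. -/
lemma bondTerm_mulVec (f : Fin NF) (θ : ℝ) {k : Fin L} (hk : finRotate L k ≠ k)
    (φ : (Fin L → Occ NF) → ℂ) (s : Fin L → Occ NF) :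
    (bondTerm f θ k + (bondTerm f θ k).conjTranspose).mulVec φ s =
      bondCoeff f θ k s * φ (s + unit k f + unit (finRotate L k) f) := by
  have hexp : star (Complex.exp (Complex.I * θ)) = Complex.exp (-(Complex.I * θ)) := by
    rw [Complex.star_def, ← Complex.exp_conj]
    simp
  have h1 : (s + unit (finRotate L k) f) k f = s k f := by
    rw [add_unit_apply, if_neg fun h => hk h.1.symm, add_zero]
  have h2 : (s + unit k f) (finRotate L k) f = s (finRotate L k) f := by
    rw [add_unit_apply, if_neg fun h => hk h.1, add_zero]
  have hcomm : s + unit (finRotate L k) f + unit k f = s + unit k f + unit (finRotate L k) f :=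
    add_right_comm _ _ _
  simp only [bondTerm, annihilationNext_eq, Matrix.conjTranspose_add, Matrix.conjTranspose_mul,
    Matrix.conjTranspose_smul, Matrix.conjTranspose_conjTranspose, hexp, star_boundarySign,
    Matrix.add_mulVec, Matrix.smul_mulVec, ← Matrix.mulVec_mulVec, Matrix.smul_mul,
    Pi.add_apply, Pi.smul_apply, smul_eq_mul,
    annihilation_mulVec, annihilation_conjTranspose_mulVec, h1, h2, hcomm, bondCoeff]
  rcases zmod_two_eq (s k f) with h | h <;>
  rcases zmod_two_eq (s (finRotate L k) f) with h' | h' <;>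
  simp only [h, h', if_true, zero_ne_one, one_ne_zero, if_false, mul_zero, add_zero, zero_add,
    mul_one] <;> ring

/-- The energy of a bond is bounded by the norm. -/
lemma re_dotProduct_bondTerm_le (f : Fin NF) (θ : ℝ) {k : Fin L} (hk : finRotate L k ≠ k)
    (φ : (Fin L → Occ NF) → ℂ) :
    (star φ ⬝ᵥ (bondTerm f θ k + (bondTerm f θ k).conjTranspose).mulVec φ).re ≤
      (star φ ⬝ᵥ φ).re := by
  have hn : (star φ ⬝ᵥ φ).re = ∑ s, ‖φ s‖ ^ 2 := by
    simp only [dotProduct, Pi.star_apply, Complex.star_def, Complex.conj_mul', Complex.re_sum]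
    norm_cast
  -- Translation by the two flips permutes the configurations, so the termwise inequality `2|ab| ≤
  -- |a|² + |b|²` sums to the squared norm.
  let ρ : Equiv.Perm (Fin L → Occ NF) := Equiv.addRight (unit k f + unit (finRotate L k) f)
  have hρ : ∑ s, ‖φ (ρ s)‖ ^ 2 = ∑ s, ‖φ s‖ ^ 2 := Equiv.sum_comp ρ fun s => ‖φ s‖ ^ 2
  have h1 : ∀ s, (star (φ s) * (bondCoeff f θ k s * φ (ρ s))).re ≤
      (‖φ s‖ ^ 2 + ‖φ (ρ s)‖ ^ 2) / 2 := by
    intro s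
    refine (Complex.re_le_norm _).trans ?_
    rw [norm_mul, norm_mul, norm_star, norm_bondCoeff, one_mul]
    nlinarith [sq_nonneg (‖φ s‖ - ‖φ (ρ s)‖)]
  have h2 : (star φ ⬝ᵥ (bondTerm f θ k + (bondTerm f θ k).conjTranspose).mulVec φ).re =
      ∑ s, (star (φ s) * (bondCoeff f θ k s * φ (ρ s))).re := by
    simp only [dotProduct, Pi.star_apply, Complex.re_sum, bondTerm_mulVec f θ hk, ρ,
      Equiv.coe_addRight, ← add_assoc]
  rw [h2, hn]
  refine (Finset.sum_le_sum fun s _ => h1 s).trans ?_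
  rw [← Finset.sum_div, Finset.sum_add_distrib, hρ]
  linarith

end Fock

/-! ### Jordan–Wigner signs and the Kitaev state -/

section Ground

variable {L NF : ℕ}

/-- The sign character of `ℤ/2`. -/
def parSign (a : ZMod 2) : ℂ := (-1) ^ a.val

lemma parSign_zero : parSign 0 = 1 := by simp [parSign]

lemma parSign_one : parSign 1 = -1 := by simp [parSign, ZMod.val_one]

lemma parSign_add (a b : ZMod 2) : parSign (a + b) = parSign a * parSign b := by
  rcases zmod_two_eq a with rfl | rfl <;> rcases zmod_two_eq b with rfl | rfl
  · simp [parSign_zero]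
  · simp [parSign_zero]
  · simp [parSign_zero]
  · rw [show (1 + 1 : ZMod 2) = 0 from rfl, parSign_zero, parSign_one]
    norm_num

lemma neg_one_pow_eq_parSign (n : ℕ) : (-1 : ℂ) ^ n = parSign (n : ZMod 2) := by
  induction n with
  | zero => simp [parSign_zero]
  | succ n ih => rw [pow_succ, ih, Nat.cast_succ, parSign_add, parSign_one]

/-- Only flavor `f` is occupied. -/
def OnlyFlavor (f : Fin NF) (s : Fin L → Occ NF) : Prop := ∀ j g, g ≠ f → s j g = 0

lemma OnlyFlavor.add_unit {f : Fin NF} {s : Fin L → Occ NF} (hs : OnlyFlavor f s) (k : Fin L) :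
    OnlyFlavor f (s + unit k f) := fun j g hg => by
  rw [add_unit_apply, hs j g hg, if_neg fun h => hg h.2, add_zero]

/-- The number modulo two of fermions of flavor `f` to the left of site `j`. -/
def leftParity (f : Fin NF) (s : Fin L → Occ NF) (j : Fin L) : ZMod 2 :=
  ∑ i, if i < j then s i f else 0

lemma leftParity_add_unit (f : Fin NF) (s : Fin L → Occ NF) (k j : Fin L) :
    leftParity f (s + unit k f) j = leftParity f s j + if k < j then 1 else 0 := by
  have : ∀ i, (if i < j then (s + unit k f) i f else 0) =
      (if i < j then s i f else 0) + if i = k then (if k < j then (1 : ZMod 2) else 0) else 0 := by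
    intro i
    rw [add_unit_apply]
    by_cases hi : i = k
    · subst hi
      split_ifs <;> simp_all
    · simp [hi]
  rw [leftParity, leftParity, Finset.sum_congr rfl fun i _ => this i, Finset.sum_add_distrib,
    Finset.sum_ite_eq' Finset.univ k, if_pos (Finset.mem_univ k)]

/-- Earlier modes on the same site carry other flavors and are empty, so only the sites to the left
count. -/
lemma OnlyFlavor.jwSign_eq {f : Fin NF} {s : Fin L → Occ NF} (hs : OnlyFlavor f s) (j : Fin L) :
    jwSign j f s = parSign (leftParity f s j) := by
  rw [jwSign, neg_one_pow_eq_parSign]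
  congr 1
  rw [Finset.card_filter, Nat.cast_sum, Fintype.sum_prod_type]
  refine Finset.sum_congr rfl fun i _ => ?_
  rw [Finset.sum_eq_single f]
  · simp only [lt_irrefl, and_false, or_false]
    rcases zmod_two_eq (s i f) with h | h <;> simp [h]
  · intro g _ hg
    simp [hs i g hg]
  · simp

lemma OnlyFlavor.parity_eq {f : Fin NF} {s : Fin L → Occ NF} (hs : OnlyFlavor f s) (j : Fin L) :
    parity (s j) = s j f := by
  rw [parity, Finset.sum_eq_single f]
  · intro g _ hg
    exact hs j g hg
  · simp

lemma finRotate_val_of_lt {k : Fin L} (h : (k : ℕ) + 1 ≠ L) : (finRotate L k : ℕ) = k + 1 := by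
  obtain _ | L := L
  · exact k.elim0
  · exact coe_finRotate_of_ne_last fun h' => h (by rw [h', Fin.val_last])

lemma finRotate_val_of_eq {k : Fin L} (h : (k : ℕ) + 1 = L) : (finRotate L k : ℕ) = 0 := by
  obtain _ | L := L
  · exact k.elim0
  · have : k = Fin.last L := Fin.ext (by simpa using h)
    rw [this, finRotate_last]
    rfl

lemma finRotate_ne (hL : 2 ≤ L) (k : Fin L) : finRotate L k ≠ k := by
  intro h
  have h' := congrArg Fin.val h
  by_cases hk : (k : ℕ) + 1 = L
  · rw [finRotate_val_of_eq hk] at h'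
    omega
  · rw [finRotate_val_of_lt hk] at h'
    omega

lemma leftParity_of_val_zero (f : Fin NF) (s : Fin L → Occ NF) {j : Fin L} (hj : (j : ℕ) = 0) :
    leftParity f s j = 0 :=
  Finset.sum_eq_zero fun i _ => if_neg fun h => by
    have := Fin.lt_def.1 h
    omega

lemma leftParity_last (f : Fin NF) (s : Fin L → Occ NF) {k : Fin L} (hk : (k : ℕ) + 1 = L) :
    leftParity f s k + s k f = ∑ i, s i f := by
  have h1 : s k f = ∑ i, if i = k then s i f else 0 := by simp
  rw [h1, leftParity, ← Finset.sum_add_distrib]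
  refine Finset.sum_congr rfl fun i _ => ?_
  by_cases h : i = k
  · simp [h]
  · have h2 : (i : ℕ) ≠ k := fun h' => h (Fin.ext h')
    have : i < k := Fin.lt_def.2 (by omega)
    simp [h, this]

lemma leftParity_succ (f : Fin NF) (s : Fin L → Occ NF) {k j : Fin L} (hj : (j : ℕ) = k + 1) :
    leftParity f s j = leftParity f s k + s k f := by
  have h1 : s k f = ∑ i, if i = k then s i f else 0 := by simp
  rw [h1, leftParity, leftParity, ← Finset.sum_add_distrib]
  refine Finset.sum_congr rfl fun i _ => ?_
  by_cases h : i = k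
  · subst h
    have : i < j := Fin.lt_def.2 (by omega)
    simp [this]
  · have h2 : (i : ℕ) ≠ k := fun h' => h (Fin.ext h')
    have : i < j ↔ i < k := by
      rw [Fin.lt_def, Fin.lt_def]
      omega
    simp [h, this]

/-- The signs of the bond terms in the sector of even parity. -/
lemma bondCoeff_eq (hL : 2 ≤ L) {f : Fin NF} {s : Fin L → Occ NF} (hs : OnlyFlavor f s)
    (hpar : ∑ i, s i f = 0) (θ : ℝ) (k : Fin L) :
    bondCoeff f θ k s =
      if s k f = 0 then if s (finRotate L k) f = 1 then 1 else Complex.exp (Complex.I * θ)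
      else if s (finRotate L k) f = 0 then 1 else Complex.exp (-(Complex.I * θ)) := by
  have h2 : ∀ a : ZMod 2, a + a = 0 := CharTwo.add_self_eq_zero
  rw [bondCoeff, hs.jwSign_eq, hs.jwSign_eq, (hs.add_unit _).jwSign_eq, (hs.add_unit _).jwSign_eq,
    leftParity_add_unit, leftParity_add_unit, ← parSign_add, ← parSign_add]
  -- For the closing bond, the string over the whole chain gives a sign. In the even sector the
  -- anti-periodic factor `-1` cancels it, and the bond looks like any other.
  by_cases hk : (k : ℕ) + 1 = L
  · have h0 := leftParity_of_val_zero f s (finRotate_val_of_eq hk)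
    have h1 := leftParity_last f s hk
    rw [hpar] at h1
    have hlt : finRotate L k < k := Fin.lt_def.2 (by rw [finRotate_val_of_eq hk]; omega)
    have hlt' : ¬ k < finRotate L k := hlt.asymm
    rw [h0, boundarySign, if_pos hk, if_pos hlt, if_neg hlt']
    rcases zmod_two_eq (s k f) with h | h
    · rw [h, add_zero] at h1
      simp [h, h1, parSign_one]
    · have h1' : leftParity f s k = 1 := by
        rw [h] at h1
        generalize leftParity f s k = a at h1 ⊢
        revert a
        decide
      simp [h, h1', parSign_one]
  · have h1 := leftParity_succ f s (finRotate_val_of_lt hk)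
    have hlt : k < finRotate L k := Fin.lt_def.2 (by rw [finRotate_val_of_lt hk]; omega)
    have hlt' : ¬ finRotate L k < k := hlt.asymm
    rw [h1, boundarySign, if_neg hk, if_pos hlt, if_neg hlt']
    rcases zmod_two_eq (s k f) with h | h
    · rw [h, add_zero, h2, parSign_zero]
      simp
    · have e : leftParity f s k + (leftParity f s k + 1 + 1) = 0 := by
        rw [add_assoc, h2, add_zero, h2]
      rw [h, e, parSign_zero]
      simp

/-- The wave function of the Kitaev family. -/
def kitaevState (f : Fin NF) (θ : ℝ) (s : Fin L → Occ NF) : ℂ :=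
  if ∑ k, parity (s k) = 0 then 2 * ∏ k, kitaevCoeff f θ (s k) else 0

lemma state_kitaevMPS (f : Fin NF) (θ : ℝ) (L : ℕ) :
    state 1 (kitaevMPS f θ).1 L = kitaevState f θ := by
  funext s
  exact state_coeffMatrices (kitaevCoeff f θ) L s

lemma kitaevState_eq_zero {f : Fin NF} (θ : ℝ) {s : Fin L → Occ NF} (hs : ¬ OnlyFlavor f s) :
    kitaevState f θ s = 0 := by
  unfold OnlyFlavor at hs
  push Not at hs
  obtain ⟨j, g, hg, hj⟩ := hs
  have h1 : s j ≠ 0 := fun h => hj (by rw [h]; rfl)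
  have h2 : s j ≠ Pi.single f 1 := fun h => hj (by rw [h, Pi.single_eq_of_ne hg])
  have : kitaevCoeff f θ (s j) = 0 := by simp [kitaevCoeff, h1, h2]
  rw [kitaevState, Finset.prod_eq_zero (Finset.mem_univ j) this, mul_zero, ite_self]

lemma onlyFlavor_of_add_unit {f : Fin NF} {s : Fin L → Occ NF} {k : Fin L}
    (h : OnlyFlavor f (s + unit k f)) : OnlyFlavor f s := by
  have := h.add_unit k
  rwa [add_unit_add_unit] at this

lemma OnlyFlavor.kitaevCoeff_eq {f : Fin NF} {s : Fin L → Occ NF} (hs : OnlyFlavor f s) (θ : ℝ)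
    (j : Fin L) : kitaevCoeff f θ (s j) =
      if s j f = 0 then 1 / (Real.sqrt 2 : ℂ)
      else Complex.exp (Complex.I * θ / 2) / (Real.sqrt 2 : ℂ) := by
  have h : s j = Pi.single f (s j f) := by
    funext g
    by_cases hg : g = f
    · subst hg
      rw [Pi.single_eq_same]
    · rw [hs j g hg, Pi.single_eq_of_ne hg]
  rcases zmod_two_eq (s j f) with h' | h'
  · rw [if_pos h', h, h', Pi.single_zero, kitaevCoeff_zero]
  · rw [if_neg (by rw [h']; exact one_ne_zero), h, h', kitaevCoeff_single]

/-- The Kitaev state is fixed by every bond term. -/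
lemma bondTerm_mulVec_kitaevState (hL : 2 ≤ L) (f : Fin NF) (θ : ℝ) (k : Fin L) :
    (bondTerm f (-θ) k + (bondTerm f (-θ) k).conjTranspose).mulVec (kitaevState f θ) =
      kitaevState f θ := by
  funext s
  have hk := finRotate_ne hL k
  rw [bondTerm_mulVec f _ hk]
  set k' := finRotate L k with hk'
  by_cases hs : OnlyFlavor f s
  swap
  · rw [kitaevState_eq_zero θ hs, kitaevState_eq_zero θ fun h =>
      hs (onlyFlavor_of_add_unit (onlyFlavor_of_add_unit h)), mul_zero]
  have hs' := (hs.add_unit k).add_unit k'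
  have hpar : ∀ t : Fin L → Occ NF, OnlyFlavor f t → ∑ j, parity (t j) = ∑ j, t j f :=
    fun t ht => Finset.sum_congr rfl fun j _ => ht.parity_eq j
  have hval : ∀ j, (s + unit k f + unit k' f) j f =
      s j f + (if j = k then 1 else 0) + if j = k' then 1 else 0 := by
    intro j
    rw [add_unit_apply, add_unit_apply]
    simp
  have hsum : ∑ j, (s + unit k f + unit k' f) j f = ∑ j, s j f := by
    rw [Finset.sum_congr rfl fun j _ => hval j, Finset.sum_add_distrib, Finset.sum_add_distrib,
      Finset.sum_ite_eq', Finset.sum_ite_eq', if_pos (Finset.mem_univ _),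
      if_pos (Finset.mem_univ _), add_assoc, show (1 + 1 : ZMod 2) = 0 from rfl, add_zero]
  rw [kitaevState, kitaevState, hpar _ hs, hpar _ hs', hsum]
  by_cases he : ∑ j, s j f = 0
  swap
  · rw [if_neg he, if_neg he, mul_zero]
  rw [if_pos he, if_pos he, bondCoeff_eq hL hs he, ← hk']
  have hmem : k' ∈ Finset.univ.erase k := Finset.mem_erase.2 ⟨hk, Finset.mem_univ _⟩
  have hrest : ∏ j ∈ (Finset.univ.erase k).erase k',
      kitaevCoeff f θ ((s + unit k f + unit k' f) j) =
      ∏ j ∈ (Finset.univ.erase k).erase k', kitaevCoeff f θ (s j) := by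
    refine Finset.prod_congr rfl fun j hj => ?_
    have h1 := Finset.ne_of_mem_erase hj
    have h2 := Finset.ne_of_mem_erase (Finset.mem_of_mem_erase hj)
    rw [hs.kitaevCoeff_eq, hs'.kitaevCoeff_eq, hval, if_neg h1, if_neg h2, add_zero, add_zero]
  have hmul : ∀ t : Fin L → Occ NF, ∏ j, kitaevCoeff f θ (t j) =
      kitaevCoeff f θ (t k) * (kitaevCoeff f θ (t k') *
        ∏ j ∈ (Finset.univ.erase k).erase k', kitaevCoeff f θ (t j)) := fun t => by
    rw [Finset.mul_prod_erase _ (fun j => kitaevCoeff f θ (t j)) hmem,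
      Finset.mul_prod_erase _ (fun j => kitaevCoeff f θ (t j)) (Finset.mem_univ k)]
  rw [hmul, hmul s, hrest, hs.kitaevCoeff_eq, hs.kitaevCoeff_eq, hs'.kitaevCoeff_eq,
    hs'.kitaevCoeff_eq, hval, hval, if_pos rfl, if_pos rfl, if_neg hk, if_neg hk.symm, add_zero,
    add_zero]
  have h11 : (1 + 1 : ZMod 2) = 0 := rfl
  -- Creating a pair multiplies the amplitude by `e^{iθ/2}` twice. The pairing phase of `H(-θ)` is
  -- what undoes this.
  have hz : Complex.exp (Complex.I * ((-θ : ℝ) : ℂ)) *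
      (Complex.exp (Complex.I * θ / 2) * Complex.exp (Complex.I * θ / 2)) = 1 := by
    rw [← Complex.exp_add, ← Complex.exp_add, ← Complex.exp_zero]
    congr 1
    push_cast
    ring
  have hz' : Complex.exp (-(Complex.I * ((-θ : ℝ) : ℂ))) =
      Complex.exp (Complex.I * θ / 2) * Complex.exp (Complex.I * θ / 2) := by
    rw [← Complex.exp_add]
    congr 1
    push_cast
    ring
  rcases zmod_two_eq (s k f) with h | h <;> rcases zmod_two_eq (s k' f) with h' | h' <;>
    simp only [h, h', h11, zero_add, if_true, if_false, one_ne_zero, zero_ne_one, one_mul]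
  · linear_combination (2 * (1 / (Real.sqrt 2 : ℂ)) * (1 / (Real.sqrt 2 : ℂ)) *
      ∏ j ∈ (Finset.univ.erase k).erase k', kitaevCoeff f θ (s j)) * hz
  · ring
  · ring
  · rw [hz']
    ring

lemma annihilation_mulVec_kitaevState {f g : Fin NF} (hg : g ≠ f) (θ : ℝ) (k : Fin L) :
    (annihilation k g).mulVec (kitaevState f θ) = 0 := by
  funext s
  rw [annihilation_mulVec, Pi.zero_apply]
  split_ifs with h
  · rw [kitaevState_eq_zero θ, mul_zero]
    intro hs
    have := hs k g hg
    rw [add_unit_apply, h, if_pos ⟨rfl, rfl⟩] at this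
    exact absurd this (by decide)
  · rfl

lemma kitaevHamiltonian_mulVec (f : Fin NF) (L : ℕ) (θ : ℝ) (φ : (Fin L → Occ NF) → ℂ) :
    (kitaevHamiltonian f L θ).mulVec φ =
      -∑ k, (bondTerm f θ k + (bondTerm f θ k).conjTranspose).mulVec φ +
        ∑ g ∈ Finset.univ.erase f, ∑ k,
          ((annihilation k g).conjTranspose * annihilation k g).mulVec φ := by
  unfold kitaevHamiltonian
  rw [Matrix.add_mulVec, Matrix.neg_mulVec, Matrix.sum_mulVec, Matrix.sum_mulVec]
  simp only [Matrix.sum_mulVec]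
  rfl

/-- The Kitaev family consists of ground states of the Kitaev chain. -/
theorem isGroundState_kitaev (hL : 2 ≤ L) (f : Fin NF) (θ : ℝ) :
    IsGroundState (kitaevHamiltonian f L (-θ)) (state 1 (kitaevMPS f θ).1 L) := by
  rw [state_kitaevMPS]
  -- The energy is minus the number of bonds: each bond contributes at least `-1`, and the other
  -- flavors contribute number operators, which are non-negative.
  refine ⟨?_, -L, ?_, fun φ => ?_⟩
  · intro h
    have h0 := congrFun h 0
    rw [kitaevState, if_pos (by simp [parity_zero])] at h0
    simp [kitaevCoeff_zero] at h0
  · rw [kitaevHamiltonian_mulVec, Finset.sum_congr rfl fun k _ =>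
      bondTerm_mulVec_kitaevState hL f θ k]
    have : ∑ g ∈ Finset.univ.erase f, ∑ k : Fin L,
        ((annihilation k g).conjTranspose * annihilation k g).mulVec (kitaevState f θ) = 0 := by
      refine Finset.sum_eq_zero fun g hg => Finset.sum_eq_zero fun k _ => ?_
      rw [← Matrix.mulVec_mulVec, annihilation_mulVec_kitaevState (Finset.ne_of_mem_erase hg),
        Matrix.mulVec_zero]
    rw [this, add_zero, Finset.sum_const, Finset.card_univ, Fintype.card_fin]
    push_cast
    rw [neg_smul, Nat.cast_smul_eq_nsmul]
  · have hnum : 0 ≤ (star φ ⬝ᵥ ∑ g ∈ Finset.univ.erase f, ∑ k : Fin L,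
        ((annihilation k g).conjTranspose * annihilation k g).mulVec φ).re := by
      simp only [dotProduct_sum, Complex.re_sum]
      refine Finset.sum_nonneg fun g _ => Finset.sum_nonneg fun k _ => ?_
      rw [← Matrix.mulVec_mulVec, Matrix.dotProduct_mulVec, ← Matrix.star_mulVec, dotProduct,
        Complex.re_sum]
      refine Finset.sum_nonneg fun s _ => ?_
      rw [Pi.star_apply, Complex.star_def, Complex.conj_mul']
      exact_mod_cast sq_nonneg ‖(annihilation k g).mulVec φ s‖
    have hbond := Finset.sum_le_sum fun k (_ : k ∈ Finset.univ) =>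
      re_dotProduct_bondTerm_le f (-θ) (finRotate_ne hL k) φ
    rw [Finset.sum_const, Finset.card_univ, Fintype.card_fin, nsmul_eq_mul] at hbond
    rw [kitaevHamiltonian_mulVec, dotProduct_add, dotProduct_neg, dotProduct_sum, Complex.add_re,
      Complex.neg_re, Complex.re_sum]
    linarith

end Ground

end FMPS

end

theorem mainTheorem5 (NF : ℕ) (hNF : 2 ≤ NF) (f : Fin NF) :
    -- homotopy type, where the matrix of a given even label (e.g. the vacuum) is non-zero
    (∀ p : FMPS.Occ NF, FMPS.parity p = 0 →
      Nonempty (FMPS.locus 1 NF p ≃ₕ FMPS.RP (2 ^ NF - 1))) ∧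
    -- fundamental group of the vacuum locus, and its generator
    (∀ x : FMPS.locus 1 NF 0,
      Nonempty (FundamentalGroup (FMPS.locus 1 NF 0) x ≃* Multiplicative (ZMod 2))) ∧
    Subgroup.zpowers
      (FundamentalGroup.fromPath (Path.Homotopic.Quotient.mk (FMPS.kitaevLoop f))) = ⊤ ∧
    -- fundamental group of the whole gauge-quotiented space, and its generator
    PathConnectedSpace (FMPS.NonTriv 1 NF) ∧
    (∀ x : FMPS.NonTriv 1 NF,
      Nonempty (FundamentalGroup (FMPS.NonTriv 1 NF) x ≃* Multiplicative (ZMod 2))) ∧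
    Subgroup.zpowers
      (FundamentalGroup.fromPath (Path.Homotopic.Quotient.mk (FMPS.kitaevLoopFull f))) = ⊤ ∧
    -- the loop consists of ground states of the Kitaev chain, its gap phase turning once by `2π`
    (∀ L : ℕ, 2 ≤ L → ∀ θ : ℝ,
      FMPS.IsGroundState (FMPS.kitaevHamiltonian f L (-θ))
        (FMPS.state 1 (FMPS.kitaevMPS f θ).1 L)) := by
  refine ⟨fun p hp => ⟨FMPS.locusHomotopyEquiv hp f⟩,
    fun x => FMPS.nonempty_mulEquiv_zmod_two
      (FMPS.card_fundamentalGroup_locus hNF FMPS.parity_zero x),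
    FMPS.zpowers_eq_top_of_card_two
      (FMPS.card_fundamentalGroup_locus hNF FMPS.parity_zero _) (FMPS.kitaevLoop_ne_one f),
    FMPS.pathConnectedSpace_nonTriv f,
    fun x => FMPS.nonempty_mulEquiv_zmod_two (FMPS.card_fundamentalGroup_nonTriv hNF x),
    FMPS.zpowers_eq_top_of_card_two
      (FMPS.card_fundamentalGroup_nonTriv hNF _) (FMPS.kitaevLoopFull_ne_one f),
    fun L hL θ => FMPS.isGroundState_kitaev hL f θ⟩
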